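/- Let $p,q\in(1,\infty)$, let $p',q'$ be the conjugate exponents ($\frac1p+\frac1{p'}=\frac1q+\frac1{q'}=1$), and let $D_r\in[0,\infty)$, $r\in(1,\infty)$, be given constants. There is a constant $C>0$, depending only on $p,q$ and $(D_r)_{r>1}$, with the following property. Let $(\Omega,\mathcal F,\mathbb P)$ be a probability space, $J$ a countable index set, and $\mathcal U=(\mathcal U_k)_{k\in J}$, $\mathcal V=(\mathcal V_k)_{k\in J}$ two (not necessarily ordered) families of sub-$\sigma$-algebras of $\mathcal F$ with $\mathcal U_k\subseteq\mathcal V_k$ for all $k$. Suppose that $\mathcal U$ has the Doob property with constants $D_r$, that is, $\big\|\sup_k|\mathbb E(f\mid\mathcal U_k)|\big\|_{L^r}\le D_r\|f\|_{L^r}$ for all $r\in(1,\infty)$ and all $f\in L^r(\Omega)$. For $a,b\in(1,\infty)$ let $L^{b}(\mathcal V,\ell^{a}\mid\mathcal U)$ be the space of all families $X=(X_k)_{k\in J}$ of real random variables (modulo almost sure equality) such that $X_k$ is $\mathcal V_k$-measurable for each $k$ and \[\|X\|_{L^b(\mathcal V,\ell^a\mid\mathcal U)}=\Big(\mathbb E\Big(\sum_{k}\mathbb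 E\big(|X_k|^a\,\big|\,\mathcal U_k\big)\Big)^{b/a}\Big)^{1/b}<\infty,\] where the conditional expectations are those of $[0,\infty]$-valued random variables. Write $E=L^q(\mathcal V,\ell^p\mid\mathcal U)$ and $F=L^{q'}(\mathcal V,\ell^{p'}\mid\mathcal U)$; these are normed spaces. Then: 1. for all $X\in E$ and $Y\in F$, each $X_kY_k$ is integrable and $\sum_k\mathbb E|X_kY_k|<\infty$, so that $\langle X,Y\rangle=\sum_k\mathbb E X_kY_k$ is well defined; 2. $Y\mapsto\langle\,\cdot\,,Y\rangle$ is a linear isomorphism of $F$ onto the dual space $E^*$, and $C^{-1}\|Y\|_F\le\|\langle\,\cdot\,,Y\rangle\|_{E^*}\le C\|Y\|_F$ for all $Y\in F$; 3. $X\mapsto\langle X,\,\cdot\,\rangle$ is a linear isomorphism of $E$ onto the dual space $F^*$, and $C^{-1}\|X\|_E\le\|\langle X,\,\cdot\,\rangle\|_{F^*}\le C\|X\|_E$ for all $X\in E$. -/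

import Mathlib

open MeasureTheory
open scoped ENNReal NNReal

/-- The family `U` of sub-σ-algebras has the Doob property with constants `D`: for every
`r ∈ (1, ∞)` and every `f ∈ L^r(μ)`, the maximal function `M_U f = sup_k |E(f | U_k)|` satisfies
`‖M_U f‖_{L^r} ≤ D r * ‖f‖_{L^r}`.  The Doob property is the existence of such a `D`. -/
def HasDoobProperty {Ω J : Type*} {m0 : MeasurableSpace Ω} (μ : Measure Ω)
    (U : J → MeasurableSpace Ω) (D : ℝ → ℝ≥0) : Prop :=
  ∀ r : ℝ, 1 < r → ∀ f : Ω → ℝ, MemLp f (ENNReal.ofReal r) μ →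
    eLpNorm (fun ω => ⨆ k, ‖(μ[f | U k]) ω‖ₑ) (ENNReal.ofReal r) μ ≤
      (D r : ℝ≥0∞) * eLpNorm f (ENNReal.ofReal r) μ

/-- The conditional mixed norm
`‖X‖ = (E (∑_k E_{U_k} |X_k|^p)^(q/p))^(1/q)`, with values in `[0, ∞]`; here `condLExp` is the
conditional expectation of a `[0, ∞]`-valued random variable. -/
noncomputable def condMixedENorm {Ω J : Type*} {m0 : MeasurableSpace Ω} (μ : Measure Ω)
    (U : J → MeasurableSpace Ω) (p q : ℝ) (X : J → Ω → ℝ) : ℝ≥0∞ :=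
  (∫⁻ ω, (∑' k, condLExp (U k) μ (fun ω' => ‖X k ω'‖ₑ ^ p) ω) ^ (q / p) ∂μ) ^ (1 / q)

namespace CondMixed

theorem key_ineq {p : ℝ} (hp : 1 ≤ p) {c d : ℝ≥0} (hc : 0 < c) (hd : 0 < d) :
    ∃ K₁ K₂ : ℝ≥0, K₁ * c ^ p + K₂ * d ^ p = (c + d) ^ p ∧
      ∀ x y : ℝ≥0∞, (x + y) ^ p ≤ K₁ * x ^ p + K₂ * y ^ p := by
  have hs : 0 < c + d := by positivity
  have hp0 : 0 ≤ p := by linarith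
  refine ⟨(c / (c + d)) * ((c + d) / c) ^ p, (d / (c + d)) * ((c + d) / d) ^ p, ?_, ?_⟩
  · rw [mul_assoc, mul_assoc, ← NNReal.mul_rpow, ← NNReal.mul_rpow, div_mul_cancel₀ _ hc.ne',
      div_mul_cancel₀ _ hd.ne', ← add_mul, ← add_div, div_self hs.ne', one_mul]
  · intro x y
    have hw : ((c / (c + d) : ℝ≥0) : ℝ≥0∞) + ((d / (c + d) : ℝ≥0) : ℝ≥0∞) = 1 := by
      rw [← ENNReal.coe_add, ← add_div, div_self hs.ne', ENNReal.coe_one]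
    have h := ENNReal.rpow_arith_mean_le_arith_mean2_rpow _ _
      ((((c + d) / c : ℝ≥0) : ℝ≥0∞) * x) ((((c + d) / d : ℝ≥0) : ℝ≥0∞) * y) hw hp
    have e1 : c / (c + d) * ((c + d) / c) = 1 := by field_simp
    have e2 : d / (c + d) * ((c + d) / d) = 1 := by field_simp
    rw [← mul_assoc, ← mul_assoc, ← ENNReal.coe_mul, ← ENNReal.coe_mul, e1, e2,
      ENNReal.coe_one, one_mul, one_mul, ENNReal.mul_rpow_of_nonneg _ _ hp0,
      ENNReal.mul_rpow_of_nonneg _ _ hp0, ← mul_assoc, ← mul_assoc,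
      ← ENNReal.coe_rpow_of_nonneg _ hp0, ← ENNReal.coe_rpow_of_nonneg _ hp0,
      ← ENNReal.coe_mul, ← ENNReal.coe_mul] at h
    exact h

/-- Minkowski's inequality for conditional expectations. -/
theorem condLExp_Lp_add_le {Ω : Type*} {m m0 : MeasurableSpace Ω} {μ : Measure Ω} {p : ℝ}
    (hp : 1 ≤ p) {f g : Ω → ℝ≥0∞} (hf : AEMeasurable f μ) :
    ∀ᵐ ω ∂μ, (condLExp m μ (fun ω' => (f ω' + g ω') ^ p) ω) ^ (1 / p) ≤
      (condLExp m μ (fun ω' => f ω' ^ p) ω) ^ (1 / p) +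
        (condLExp m μ (fun ω' => g ω' ^ p) ω) ^ (1 / p) := by
  have hp0 : 0 < p := by linarith
  have H : ∀ c d : ℚ, 0 < c → 0 < d → ∀ᵐ ω ∂μ,
      (condLExp m μ (fun ω' => f ω' ^ p) ω) ^ (1 / p) ≤ (Real.toNNReal c : ℝ≥0∞) →
      (condLExp m μ (fun ω' => g ω' ^ p) ω) ^ (1 / p) ≤ (Real.toNNReal d : ℝ≥0∞) →
      (condLExp m μ (fun ω' => (f ω' + g ω') ^ p) ω) ^ (1 / p) ≤
        (Real.toNNReal c : ℝ≥0∞) + (Real.toNNReal d : ℝ≥0∞) := by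
    intro c d hc hd
    have hc' : 0 < Real.toNNReal c := by simpa using hc
    have hd' : 0 < Real.toNNReal d := by simpa using hd
    obtain ⟨K₁, K₂, hK, hle⟩ := key_ineq hp hc' hd'
    have h1 : condLExp m μ (fun ω' => (f ω' + g ω') ^ p) ≤ᵐ[μ]
        condLExp m μ (((K₁ : ℝ≥0∞) • fun ω' => f ω' ^ p) + ((K₂ : ℝ≥0∞) • fun ω' => g ω' ^ p)) :=
      condLExp_mono (Filter.Eventually.of_forall fun ω => hle _ _)
    have h2 := condLExp_add_left (mΩ := m) (P := μ) ((K₂ : ℝ≥0∞) • fun ω' => g ω' ^ p)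
      (X := (K₁ : ℝ≥0∞) • fun ω' => f ω' ^ p) ((hf.pow_const p).const_smul _)
    have h3 := condLExp_smul' (mΩ := m) (P := μ) (fun ω' => f ω' ^ p) (c := K₁) ENNReal.coe_ne_top
    have h4 := condLExp_smul' (mΩ := m) (P := μ) (fun ω' => g ω' ^ p) (c := K₂) ENNReal.coe_ne_top
    filter_upwards [h1, h2, h3, h4] with ω h1 h2 h3 h4 ha hb
    rw [one_div, ENNReal.rpow_inv_le_iff hp0] at ha hb ⊢
    refine h1.trans ?_
    rw [h2, Pi.add_apply, h3, h4, Pi.smul_apply, Pi.smul_apply, smul_eq_mul, smul_eq_mul]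
    calc _ ≤ (K₁ : ℝ≥0∞) * (Real.toNNReal c : ℝ≥0∞) ^ p
          + (K₂ : ℝ≥0∞) * (Real.toNNReal d : ℝ≥0∞) ^ p := by gcongr
      _ = _ := by
        rw [← ENNReal.coe_rpow_of_nonneg _ hp0.le, ← ENNReal.coe_rpow_of_nonneg _ hp0.le,
          ← ENNReal.coe_add, ← ENNReal.coe_rpow_of_nonneg _ hp0.le, ← hK]
        push_cast
        rfl
  have H' : ∀ᵐ ω ∂μ, ∀ c d : ℚ, 0 < c → 0 < d →
      (condLExp m μ (fun ω' => f ω' ^ p) ω) ^ (1 / p) ≤ (Real.toNNReal c : ℝ≥0∞) →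
      (condLExp m μ (fun ω' => g ω' ^ p) ω) ^ (1 / p) ≤ (Real.toNNReal d : ℝ≥0∞) →
      (condLExp m μ (fun ω' => (f ω' + g ω') ^ p) ω) ^ (1 / p) ≤
        (Real.toNNReal c : ℝ≥0∞) + (Real.toNNReal d : ℝ≥0∞) := by
    simp only [ae_all_iff]
    exact H
  filter_upwards [H'] with ω hω
  refine ENNReal.le_of_forall_pos_le_add fun ε hε hfin => ?_
  set a := (condLExp m μ (fun ω' => f ω' ^ p) ω) ^ (1 / p)
  set b := (condLExp m μ (fun ω' => g ω' ^ p) ω) ^ (1 / p)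
  obtain ⟨ha, hb⟩ := ENNReal.add_lt_top.1 hfin
  have hε2 : ((ε / 2 : ℝ≥0) : ℝ≥0∞) ≠ 0 := by simpa using hε.ne'
  obtain ⟨c, hc0, hac, hcε⟩ := ENNReal.lt_iff_exists_rat_btwn.1 (ENNReal.lt_add_right ha.ne hε2)
  obtain ⟨d, hd0, hbd, hdε⟩ := ENNReal.lt_iff_exists_rat_btwn.1 (ENNReal.lt_add_right hb.ne hε2)
  have hc : 0 < c := by
    rcases hc0.lt_or_eq with h | h
    · exact h
    · subst h; simp at hac
  have hd : 0 < d := by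
    rcases hd0.lt_or_eq with h | h
    · exact h
    · subst h; simp at hbd
  refine (hω c d hc hd hac.le hbd.le).trans ((add_le_add hcε.le hdε.le).trans ?_)
  have : (ε : ℝ≥0∞) = ((ε / 2 : ℝ≥0) : ℝ≥0∞) + ((ε / 2 : ℝ≥0) : ℝ≥0∞) := by
    rw [← ENNReal.coe_add, add_halves]
  rw [this]
  exact (add_add_add_comm _ _ _ _).le

theorem tsum_Lp_add_le {J : Type*} {p : ℝ} (hp : 1 ≤ p) (a b : J → ℝ≥0∞) :
    (∑' k, (a k + b k) ^ p) ^ (1 / p) ≤ (∑' k, a k ^ p) ^ (1 / p) + (∑' k, b k ^ p) ^ (1 / p) := by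
  have hp0 : 0 < p := by linarith
  rw [one_div, ENNReal.rpow_inv_le_iff hp0, ENNReal.tsum_eq_iSup_sum]
  refine iSup_le fun s => ?_
  rw [← ENNReal.rpow_inv_le_iff hp0, ← one_div]
  refine (ENNReal.Lp_add_le s a b hp).trans ?_
  gcongr
  · exact ENNReal.sum_le_tsum s
  · exact ENNReal.sum_le_tsum s

section

variable {Ω J : Type*} {m0 : MeasurableSpace Ω} {μ : Measure Ω} {U : J → MeasurableSpace Ω}
  {p q : ℝ}

theorem condMixedENorm_congr [Countable J] {X Y : J → Ω → ℝ} (h : ∀ k, X k =ᵐ[μ] Y k) :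
    condMixedENorm μ U p q X = condMixedENorm μ U p q Y := by
  unfold condMixedENorm
  congr 1
  refine lintegral_congr_ae ?_
  have h' : ∀ᵐ ω ∂μ, ∀ k, condLExp (U k) μ (fun ω' => ‖X k ω'‖ₑ ^ p) ω =
      condLExp (U k) μ (fun ω' => ‖Y k ω'‖ₑ ^ p) ω := by
    rw [ae_all_iff]
    intro k
    refine condLExp_congr_ae ?_
    filter_upwards [h k] with ω hω
    rw [hω]
  filter_upwards [h'] with ω hω
  simp_rw [hω]

theorem condMixedENorm_zero (hp : 1 ≤ p) (hq : 1 ≤ q) :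
    condMixedENorm μ U p q (fun _ _ => 0) = 0 := by
  have hp0 : 0 < p := by linarith
  have hq0 : 0 < q := by linarith
  have : ∀ k, condLExp (U k) μ (fun _ : Ω => (0 : ℝ≥0∞)) = 0 := fun k => condLExp_zero μ
  simp [condMixedENorm, ENNReal.zero_rpow_of_pos, hp0, hq0, this]

theorem condMixedENorm_add_le [Countable J] (hp : 1 ≤ p) (hq : 1 ≤ q) {X Y : J → Ω → ℝ}
    (hX : ∀ k, AEMeasurable (X k) μ) :
    condMixedENorm μ U p q (fun k ω => X k ω + Y k ω) ≤
      condMixedENorm μ U p q X + condMixedENorm μ U p q Y := by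
  have hp0 : 0 < p := by linarith
  have hq0 : 0 < q := by linarith
  have hrw : ∀ Z : J → Ω → ℝ, condMixedENorm μ U p q Z =
      (∫⁻ ω, ((∑' k, condLExp (U k) μ (fun ω' => ‖Z k ω'‖ₑ ^ p) ω) ^ (1 / p)) ^ q ∂μ) ^ (1 / q) := by
    intro Z
    unfold condMixedENorm
    congr 2
    ext ω
    rw [← ENNReal.rpow_mul, one_div_mul_eq_div]
  have hmeas : ∀ Z : J → Ω → ℝ, AEMeasurable
      (fun ω => (∑' k, condLExp (U k) μ (fun ω' => ‖Z k ω'‖ₑ ^ p) ω) ^ (1 / p)) μ := by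
    intro Z
    exact ((Measurable.tsum fun k => measurable_condLExp' _ _ _).pow_const _).aemeasurable
  rw [hrw, hrw, hrw]
  refine le_trans ?_ (ENNReal.lintegral_Lp_add_le (hmeas X) (hmeas Y) hq)
  gcongr ?_ ^ (1 / q)
  refine lintegral_mono_ae ?_
  have h1 : ∀ᵐ ω ∂μ, ∀ k, condLExp (U k) μ (fun ω' => ‖X k ω' + Y k ω'‖ₑ ^ p) ω ≤
      condLExp (U k) μ (fun ω' => (‖X k ω'‖ₑ + ‖Y k ω'‖ₑ) ^ p) ω := by
    rw [ae_all_iff]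
    intro k
    refine condLExp_mono (Filter.Eventually.of_forall fun ω => ?_)
    exact ENNReal.rpow_le_rpow (enorm_add_le (X k ω) (Y k ω)) hp0.le
  have h2 : ∀ᵐ ω ∂μ, ∀ k,
      (condLExp (U k) μ (fun ω' => (‖X k ω'‖ₑ + ‖Y k ω'‖ₑ) ^ p) ω) ^ (1 / p) ≤
      (condLExp (U k) μ (fun ω' => ‖X k ω'‖ₑ ^ p) ω) ^ (1 / p) +
        (condLExp (U k) μ (fun ω' => ‖Y k ω'‖ₑ ^ p) ω) ^ (1 / p) := by
    rw [ae_all_iff]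
    exact fun k => condLExp_Lp_add_le hp (hX k).enorm
  filter_upwards [h1, h2] with ω h1 h2
  rw [Pi.add_apply]
  gcongr ?_ ^ q
  have hcancel : ∀ x : ℝ≥0∞, (x ^ (1 / p)) ^ p = x := fun x => by
    rw [← ENNReal.rpow_mul, one_div_mul_cancel hp0.ne', ENNReal.rpow_one]
  have h3 := tsum_Lp_add_le hp
    (fun k => (condLExp (U k) μ (fun ω' => ‖X k ω'‖ₑ ^ p) ω) ^ (1 / p))
    (fun k => (condLExp (U k) μ (fun ω' => ‖Y k ω'‖ₑ ^ p) ω) ^ (1 / p))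
  simp only [hcancel] at h3
  refine le_trans ?_ h3
  gcongr with k
  rw [← ENNReal.rpow_inv_le_iff hp0, ← one_div]
  exact (ENNReal.rpow_le_rpow (h1 k) (by positivity)).trans (h2 k)

theorem condMixedENorm_smul [Countable J] (hp : 1 ≤ p) (hq : 1 ≤ q) (c : ℝ) (X : J → Ω → ℝ) :
    condMixedENorm μ U p q (fun k ω => c * X k ω) = ‖c‖ₑ * condMixedENorm μ U p q X := by
  have hp0 : 0 < p := by linarith
  have hq0 : 0 < q := by linarith
  have h : ∀ᵐ ω ∂μ, ∀ k, condLExp (U k) μ (fun ω' => ‖c * X k ω'‖ₑ ^ p) ω =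
      ‖c‖ₑ ^ p * condLExp (U k) μ (fun ω' => ‖X k ω'‖ₑ ^ p) ω := by
    rw [ae_all_iff]
    intro k
    have h1 := condLExp_smul' (mΩ := U k) (P := μ) (fun ω' => ‖X k ω'‖ₑ ^ p) (c := ‖c‖ₑ ^ p)
      (ENNReal.rpow_ne_top_of_nonneg hp0.le enorm_ne_top)
    have h2 : (fun ω' => ‖c * X k ω'‖ₑ ^ p) = (‖c‖ₑ ^ p) • fun ω' => ‖X k ω'‖ₑ ^ p := by
      ext ω
      simp [enorm_mul, ENNReal.mul_rpow_of_nonneg _ _ hp0.le]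
    rw [h2]
    filter_upwards [h1] with ω h1
    rw [h1]
    rfl
  unfold condMixedENorm
  have h3 : ∀ᵐ ω ∂μ, (∑' k, condLExp (U k) μ (fun ω' => ‖c * X k ω'‖ₑ ^ p) ω) ^ (q / p) =
      ‖c‖ₑ ^ q * (∑' k, condLExp (U k) μ (fun ω' => ‖X k ω'‖ₑ ^ p) ω) ^ (q / p) := by
    filter_upwards [h] with ω h
    simp_rw [h]
    rw [ENNReal.tsum_mul_left, ENNReal.mul_rpow_of_nonneg _ _ (by positivity), ← ENNReal.rpow_mul,
      mul_div_cancel₀ _ hp0.ne']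
  rw [lintegral_congr_ae h3, lintegral_const_mul' _ _
    (ENNReal.rpow_ne_top_of_nonneg hq0.le enorm_ne_top),
    ENNReal.mul_rpow_of_nonneg _ _ (by positivity), ← ENNReal.rpow_mul,
    mul_one_div_cancel hq0.ne', ENNReal.rpow_one]

theorem eq_zero_of_condMixedENorm [Countable J] [IsProbabilityMeasure μ] (hU : ∀ k, U k ≤ m0)
    (hp : 1 ≤ p) (hq : 1 ≤ q) {X : J → Ω → ℝ} (hX : ∀ k, AEMeasurable (X k) μ)
    (h : condMixedENorm μ U p q X = 0) (k : J) : X k =ᵐ[μ] 0 := by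
  have hp0 : 0 < p := by linarith
  have hq0 : 0 < q := by linarith
  unfold condMixedENorm at h
  rw [ENNReal.rpow_eq_zero_iff_of_pos (by positivity), lintegral_eq_zero_iff'
    ((Measurable.tsum fun k => measurable_condLExp' _ _ _).pow_const _).aemeasurable] at h
  have h1 : condLExp (U k) μ (fun ω' => ‖X k ω'‖ₑ ^ p) =ᵐ[μ] 0 := by
    filter_upwards [h] with ω hω
    rw [Pi.zero_apply, ENNReal.rpow_eq_zero_iff_of_pos (by positivity), ENNReal.tsum_eq_zero] at hω
    exact hω k
  have h2 := lintegral_condLExp (hU k) μ (fun ω' => ‖X k ω'‖ₑ ^ p)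
  rw [lintegral_congr_ae h1] at h2
  simp only [Pi.zero_apply, lintegral_zero] at h2
  have h3 := (lintegral_eq_zero_iff' ((hX k).enorm.pow_const p)).1 h2.symm
  filter_upwards [h3] with ω hω
  simpa [ENNReal.rpow_eq_zero_iff_of_pos hp0] using hω

end

end CondMixed

/-- The `V`-adapted families `(X_k)` of real random variables (modulo almost sure equality) with
finite conditional mixed norm, as a linear subspace of all families of random variables. -/
noncomputable def condMixedSubmodule {Ω J : Type*} [Countable J] {m0 : MeasurableSpace Ω}
    (μ : Measure Ω) (V U : J → MeasurableSpace Ω) {p q : ℝ} (hp : 1 ≤ p) (hq : 1 ≤ q) :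
    Submodule ℝ (J → Ω →ₘ[μ] ℝ) where
  carrier := {X | (∀ k, AEStronglyMeasurable[V k] (X k) μ) ∧
    condMixedENorm μ U p q (fun k => X k) < ∞}
  zero_mem' := by
    refine ⟨fun k => ?_, ?_⟩
    · exact (aestronglyMeasurable_const (b := (0 : ℝ))).congr AEEqFun.coeFn_zero.symm
    · refine (CondMixed.condMixedENorm_congr (Y := fun _ _ => 0)
        fun k => AEEqFun.coeFn_zero).trans_lt ?_
      rw [CondMixed.condMixedENorm_zero hp hq]
      exact ENNReal.zero_lt_top
  add_mem' := by
    rintro X Y ⟨hX, hX'⟩ ⟨hY, hY'⟩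
    refine ⟨fun k => ((hX k).add (hY k)).congr (AEEqFun.coeFn_add _ _).symm, ?_⟩
    refine (CondMixed.condMixedENorm_congr (Y := fun k ω => X k ω + Y k ω)
      fun k => AEEqFun.coeFn_add (X k) (Y k)).trans_lt ?_
    exact (CondMixed.condMixedENorm_add_le hp hq fun k => (X k).aemeasurable).trans_lt (ENNReal.add_lt_top.2 ⟨hX', hY'⟩)
  smul_mem' := by
    rintro c X ⟨hX, hX'⟩
    refine ⟨fun k => ((hX k).const_smul c).congr (AEEqFun.coeFn_smul _ _).symm, ?_⟩
    refine (CondMixed.condMixedENorm_congr (Y := fun k ω => c * X k ω)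
      fun k => AEEqFun.coeFn_smul c (X k)).trans_lt ?_
    rw [CondMixed.condMixedENorm_smul hp hq]
    exact ENNReal.mul_lt_top enorm_lt_top hX'

/-- The conditional mixed-norm space `L^q(V, ℓ^p | U)`. -/
def CondMixedLp {Ω J : Type*} [Countable J] {m0 : MeasurableSpace Ω} (μ : Measure Ω)
    (V U : J → MeasurableSpace Ω) (_hU : ∀ k, U k ≤ m0) {p q : ℝ} (hp : 1 ≤ p) (hq : 1 ≤ q) :
    Type _ :=
  condMixedSubmodule μ V U hp hq

namespace CondMixedLp

section

variable {Ω J : Type*} [Countable J] {m0 : MeasurableSpace Ω} {μ : Measure Ω}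
  {V U : J → MeasurableSpace Ω} {hU : ∀ k, U k ≤ m0} {p q : ℝ} {hp : 1 ≤ p} {hq : 1 ≤ q}

noncomputable instance instAddCommGroup : AddCommGroup (CondMixedLp μ V U hU hp hq) :=
  inferInstanceAs (AddCommGroup (condMixedSubmodule μ V U hp hq))

noncomputable instance instModule : Module ℝ (CondMixedLp μ V U hU hp hq) :=
  inferInstanceAs (Module ℝ (condMixedSubmodule μ V U hp hq))

/-- The `k`-th random variable of the family `X`. -/
def coord (X : CondMixedLp μ V U hU hp hq) (k : J) : Ω →ₘ[μ] ℝ := X.1 k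

theorem toReal_condMixedENorm_smul (c : ℝ) (X : CondMixedLp μ V U hU hp hq) :
    (condMixedENorm μ U p q (fun k => (c • X).coord k)).toReal =
      ‖c‖ * (condMixedENorm μ U p q (fun k => X.coord k)).toReal := by
  have h : condMixedENorm μ U p q (fun k => (c • X).coord k) =
      condMixedENorm μ U p q (fun k ω => c * X.coord k ω) :=
    CondMixed.condMixedENorm_congr fun k => AEEqFun.coeFn_smul c (X.coord k)
  rw [h, CondMixed.condMixedENorm_smul hp hq, ENNReal.toReal_mul, toReal_enorm]

noncomputable instance instNormedAddCommGroup [IsProbabilityMeasure μ] :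
    NormedAddCommGroup (CondMixedLp μ V U hU hp hq) :=
  AddGroupNorm.toNormedAddCommGroup
    { toFun := fun X => (condMixedENorm μ U p q (fun k => X.coord k)).toReal
      map_zero' := by
        simpa using toReal_condMixedENorm_smul (0 : ℝ) (0 : CondMixedLp μ V U hU hp hq)
      add_le' := fun X Y => by
        have h : condMixedENorm μ U p q (fun k => (X + Y).coord k) =
            condMixedENorm μ U p q (fun k ω => X.coord k ω + Y.coord k ω) :=
          CondMixed.condMixedENorm_congr fun k => AEEqFun.coeFn_add (X.coord k) (Y.coord k)
        have hX : condMixedENorm μ U p q (fun k => X.coord k) < ∞ := X.2.2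
        have hY : condMixedENorm μ U p q (fun k => Y.coord k) < ∞ := Y.2.2
        rw [h, ← ENNReal.toReal_add hX.ne hY.ne]
        exact ENNReal.toReal_mono (ENNReal.add_lt_top.2 ⟨hX, hY⟩).ne
          (CondMixed.condMixedENorm_add_le hp hq fun k => (X.coord k).aemeasurable)
      neg' := fun X => by
        simpa using toReal_condMixedENorm_smul (-1 : ℝ) X
      eq_zero_of_map_eq_zero' := fun X h => by
        have hX : condMixedENorm μ U p q (fun k => X.coord k) < ∞ := X.2.2
        have h0 := ((ENNReal.toReal_eq_zero_iff _).1 h).resolve_right hX.ne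
        refine Subtype.ext (funext fun k => AEEqFun.ext ?_)
        exact (CondMixed.eq_zero_of_condMixedENorm hU hp hq (fun k => (X.coord k).aemeasurable)
          h0 k).trans AEEqFun.coeFn_zero.symm }

theorem norm_def [IsProbabilityMeasure μ] (X : CondMixedLp μ V U hU hp hq) :
    ‖X‖ = (condMixedENorm μ U p q (fun k => X.coord k)).toReal := rfl

noncomputable instance instNormedSpace [IsProbabilityMeasure μ] :
    NormedSpace ℝ (CondMixedLp μ V U hU hp hq) where
  norm_smul_le c X := (toReal_condMixedENorm_smul c X).le

end

end CondMixedLp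

/-! One half is Hölder's inequality, used three times: conditionally on each `U k`, then for the sum
over `k`, then for the integral. It makes the pairing well defined with norm at most 1, without the
Doob property (`tsum_lintegral_mul_le`).

The Doob property enters once, in the lower bound for `Y` in `F` when `q ≤ p`. Put `S = ∑_k
E(|Y_k|^p' | U_k)`, `h = S^(q'/p' - 1)` and test on `X_k = sgn(Y_k) |Y_k|^(p'-1) E(h | U_k)`. Since
conditional expectation is self-adjoint, `⟨X, Y⟩ = E(h S) = ‖Y‖^q'`. By the pull-out property
`E(|X_k|^p | U_k) = E(h | U_k)^p E(|Y_k|^p' | U_k)`. Replacing `E(h | U_k)` by `M = sup_k E(h |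
U_k)` gives `‖X‖^q ≤ E(M^q S^(q/p))`. Hölder's inequality and the maximal inequality in `L^r`, `r =
q'/(q' - p')`, bound this by a constant times `E S^(q'/p')`, because `h^r = S^(q'/p')`
(`lintegral_iSup_condLExp_weight_le`, `exists_norming`).

A lower bound implies surjectivity (`pairing_surjective`). A functional on `E` is represented on
indicator families by Radon–Nikodym densities `y_k`. Bounded truncations of `y` lie in `F` and
represent the functional composed with a contraction, so the lower bound controls their norms
uniformly; monotone convergence puts `y` itself in `F`. Indicator families span a dense subspace of
`E`, so `y` represents the functional everywhere.

Once `F` is known to be the dual of `E`, Hahn–Banach gives the lower bound for `E` in the dual of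
`F` (`norm_le_norm_pairing_symm`), and the same surjectivity argument applies with the roles
exchanged. The case `p ≤ q` is the case above for the conjugate exponents. -/

namespace CondMixed

open Filter Topology

/-! ### Conditional expectations of `[0, ∞]`-valued functions -/

section CondLExp

variable {Ω : Type*} {m m0 : MeasurableSpace Ω} {μ : Measure Ω}

theorem withDensity_condLExp_trim (hm : m ≤ m0) [SigmaFinite (μ.trim hm)] (f : Ω → ℝ≥0∞) :
    (μ.withDensity (condLExp m μ f)).trim hm = (μ.withDensity f).trim hm := by
  refine @Measure.ext _ m _ _ fun s hs => ?_
  rw [trim_measurableSet_eq hm hs, trim_measurableSet_eq hm hs, withDensity_apply _ (hm s hs),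
    withDensity_apply _ (hm s hs), setLIntegral_condLExp hm μ f hs]

/-- The defining property of the conditional expectation, tested against functions. -/
theorem lintegral_mul_condLExp (hm : m ≤ m0) [SigmaFinite (μ.trim hm)] {f g : Ω → ℝ≥0∞}
    (hf : AEMeasurable f μ) (hg : Measurable[m] g) :
    ∫⁻ ω, g ω * condLExp m μ f ω ∂μ = ∫⁻ ω, g ω * f ω ∂μ := by
  have hg' : AEMeasurable g μ := (hg.mono hm le_rfl).aemeasurable
  have h1 := lintegral_withDensity_eq_lintegral_mul₀
    (measurable_condLExp' m μ f).aemeasurable hg'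
  have h2 := lintegral_withDensity_eq_lintegral_mul₀ hf hg'
  rw [← lintegral_trim hm hg] at h1 h2
  rw [withDensity_condLExp_trim hm, h2] at h1
  simpa [mul_comm] using h1.symm

/-- The conditional expectation is self-adjoint. -/
theorem lintegral_condLExp_mul_comm (hm : m ≤ m0) [SigmaFinite (μ.trim hm)] {f g : Ω → ℝ≥0∞}
    (hf : AEMeasurable f μ) (hg : AEMeasurable g μ) :
    ∫⁻ ω, condLExp m μ f ω * g ω ∂μ = ∫⁻ ω, f ω * condLExp m μ g ω ∂μ := by
  rw [← lintegral_mul_condLExp hm hg (measurable_condLExp m μ f)]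
  simp_rw [mul_comm (condLExp m μ f _), mul_comm (f _)]
  exact lintegral_mul_condLExp hm hf (measurable_condLExp m μ g)

/-- The pull-out property. -/
theorem condLExp_mul_left (hm : m ≤ m0) [SigmaFinite (μ.trim hm)] {f g : Ω → ℝ≥0∞}
    (hf : AEMeasurable f μ) (hg : Measurable[m] g) :
    condLExp m μ (fun ω => g ω * f ω) =ᵐ[μ] fun ω => g ω * condLExp m μ f ω := by
  refine (ae_eq_condLExp hm μ _ (hg.mul (measurable_condLExp m μ f)) fun s hs => ?_).symm
  have h := lintegral_mul_condLExp hm hf (hg.indicator hs)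
  simpa [← Set.indicator_mul_left, lintegral_indicator (hm s hs)] using h

/-- Monotone convergence: integrated over a set of `m`, both sides become the supremum of the same
integrals. -/
theorem condLExp_iSup (hm : m ≤ m0) [SigmaFinite (μ.trim hm)] {f : ℕ → Ω → ℝ≥0∞}
    (hf : ∀ n, AEMeasurable (f n) μ) (hmono : ∀ᵐ ω ∂μ, Monotone fun n => f n ω) :
    condLExp m μ (fun ω => ⨆ n, f n ω) =ᵐ[μ] fun ω => ⨆ n, condLExp m μ (f n) ω := by
  have hmono' : ∀ᵐ ω ∂μ, Monotone fun n => condLExp m μ (f n) ω := by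
    have h : ∀ n, condLExp m μ (f n) ≤ᵐ[μ] condLExp m μ (f (n + 1)) := fun n =>
      condLExp_mono (hmono.mono fun ω h => h n.le_succ)
    filter_upwards [ae_all_iff.2 h] with ω hω
    exact monotone_nat_of_le_succ hω
  refine (ae_eq_condLExp hm μ _ (Measurable.iSup fun n => measurable_condLExp m μ (f n))
    fun s hs => ?_).symm
  rw [lintegral_iSup' (fun n => (measurable_condLExp' m μ (f n)).aemeasurable)
    (ae_restrict_of_ae hmono'), lintegral_iSup' (fun n => (hf n).restrict)
    (ae_restrict_of_ae hmono)]
  simp_rw [setLIntegral_condLExp hm μ _ hs]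

/-- The dominated convergence theorem for conditional expectations of `[0, ∞]`-valued functions;
only the conditional expectation of the bound has to be finite. -/
theorem tendsto_condLExp_zero (hm : m ≤ m0) [SigmaFinite (μ.trim hm)] {f : ℕ → Ω → ℝ≥0∞}
    {g : Ω → ℝ≥0∞} (hf : ∀ n, AEMeasurable (f n) μ) (hg : AEMeasurable g μ)
    (hfg : ∀ n, f n ≤ᵐ[μ] g) (hg_top : ∀ᵐ ω ∂μ, g ω ≠ ∞)
    (hg_fin : ∀ᵐ ω ∂μ, condLExp m μ g ω ≠ ∞)
    (hlim : ∀ᵐ ω ∂μ, Tendsto (fun n => f n ω) atTop (𝓝 0)) :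
    ∀ᵐ ω ∂μ, Tendsto (fun n => condLExp m μ (f n) ω) atTop (𝓝 0) := by
  -- The tail suprema `W n` decrease to 0, so `g - W n` increases to `g`. Monotone convergence
  -- applies to these differences, and the finiteness of `E(g | m)` allows subtracting again.
  let W : ℕ → Ω → ℝ≥0∞ := fun n ω => ⨆ i, f (n + i) ω
  have hW : ∀ n, AEMeasurable (W n) μ := fun n => AEMeasurable.iSup fun i => hf (n + i)
  have hWg : ∀ᵐ ω ∂μ, ∀ n, W n ω ≤ g ω := by
    filter_upwards [ae_all_iff.2 hfg] with ω h n
    exact iSup_le fun i => h _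
  have hWanti : ∀ ω, Antitone fun n => W n ω := fun ω =>
    antitone_nat_of_succ_le fun n => iSup_le fun i => by
      have := le_iSup (fun i => f (n + i) ω) (1 + i)
      simpa [W, add_assoc] using this
  have hWlim : ∀ᵐ ω ∂μ, Tendsto (fun n => W n ω) atTop (𝓝 0) := by
    filter_upwards [hlim] with ω h
    rw [ENNReal.tendsto_nhds_zero] at h ⊢
    intro ε hε
    obtain ⟨N, hN⟩ := eventually_atTop.1 (h ε hε)
    exact eventually_atTop.2 ⟨N, fun n hn => iSup_le fun i => hN _ (by omega)⟩
  have hV : ∀ n, AEMeasurable (fun ω => g ω - W n ω) μ := fun n => hg.sub (hW n)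
  have hsup : (fun ω => ⨆ n, (g ω - W n ω)) =ᵐ[μ] g := by
    filter_upwards [hWlim, hg_top] with ω h htop
    refine iSup_eq_of_tendsto (fun i j hij => tsub_le_tsub_left (hWanti ω hij) _) ?_
    simpa using ENNReal.Tendsto.sub tendsto_const_nhds h (Or.inl htop)
  have hVE := (condLExp_congr_ae (mΩ := m) hsup).symm.trans
    (condLExp_iSup hm hV (ae_of_all _ fun ω i j hij => tsub_le_tsub_left (hWanti ω hij) _))
  have hadd : ∀ n, condLExp m μ g =ᵐ[μ]
      condLExp m μ (fun ω => g ω - W n ω) + condLExp m μ (W n) := fun n => by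
    refine EventuallyEq.trans (condLExp_congr_ae ?_) (condLExp_add_left (W n) (hV n))
    filter_upwards [hWg] with ω h
    simp [tsub_add_cancel_of_le (h n)]
  have hle : ∀ n, condLExp m μ (f n) ≤ᵐ[μ] condLExp m μ (W n) := fun n =>
    condLExp_mono (ae_of_all _ fun ω => by simpa using le_iSup (fun i => f (n + i) ω) 0)
  have hmono : ∀ n, condLExp m μ (fun ω => g ω - W n ω) ≤ᵐ[μ]
      condLExp m μ (fun ω => g ω - W (n + 1) ω) := fun n =>
    condLExp_mono (ae_of_all _ fun ω => tsub_le_tsub_left (hWanti ω n.le_succ) _)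
  filter_upwards [hVE, ae_all_iff.2 hadd, ae_all_iff.2 hle, hg_fin, ae_all_iff.2 hmono]
    with ω h1 h2 h3 h4 h5
  have ht : Tendsto (fun n => condLExp m μ (fun ω => g ω - W n ω) ω) atTop
      (𝓝 (condLExp m μ g ω)) := by
    rw [h1]
    exact tendsto_atTop_iSup (monotone_nat_of_le_succ h5)
  have ht' : Tendsto (fun n => condLExp m μ g ω - condLExp m μ (fun ω => g ω - W n ω) ω) atTop
      (𝓝 0) := by
    simpa using ENNReal.Tendsto.sub tendsto_const_nhds ht (Or.inl h4)
  refine tendsto_of_tendsto_of_tendsto_of_le_of_le tendsto_const_nhds ht' (fun _ => zero_le)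
    fun n => (h3 n).trans ?_
  have h6 := h2 n
  rw [Pi.add_apply] at h6
  have h7 : condLExp m μ (fun ω => g ω - W n ω) ω ≠ ∞ := by
    refine ne_top_of_le_ne_top h4 ?_
    rw [h6]
    exact le_self_add
  simp only [h6, ENNReal.add_sub_cancel_left h7]
  rfl

end CondLExp

/-- The Doob property for `[0, ∞]`-valued functions. -/
theorem lintegral_iSup_condLExp_rpow_le {Ω J : Type*} [Countable J] {m0 : MeasurableSpace Ω}
    {μ : Measure Ω} [IsProbabilityMeasure μ] {U : J → MeasurableSpace Ω} {D : ℝ → ℝ≥0}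
    (hD : HasDoobProperty μ U D) {r : ℝ} (hr : 1 < r) {h : Ω → ℝ≥0∞} (hh : AEMeasurable h μ)
    (hfin : ∫⁻ ω, h ω ^ r ∂μ ≠ ∞) :
    ∫⁻ ω, (⨆ k, condLExp (U k) μ h ω) ^ r ∂μ ≤ (D r : ℝ≥0∞) ^ r * ∫⁻ ω, h ω ^ r ∂μ := by
  have hr0 : 0 < r := by linarith
  have htop : ∀ᵐ ω ∂μ, h ω ≠ ∞ := by
    filter_upwards [ae_lt_top' (hh.pow_const r) hfin] with ω hω htop
    simp [htop, hr0] at hω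
  have hor : ENNReal.ofReal r ≠ 0 := by simpa using hr0
  have hnorm : ∀ᵐ ω ∂μ, ‖(h ω).toReal‖ₑ = h ω := by
    filter_upwards [htop] with ω hω
    rw [← ofReal_norm, Real.norm_of_nonneg ENNReal.toReal_nonneg, ENNReal.ofReal_toReal hω]
  have hint : ∫⁻ ω, ‖(h ω).toReal‖ₑ ^ r ∂μ = ∫⁻ ω, h ω ^ r ∂μ := by
    refine lintegral_congr_ae ?_
    filter_upwards [hnorm] with ω hω
    rw [hω]
  have heLp : eLpNorm (fun ω => (h ω).toReal) (ENNReal.ofReal r) μ =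
      (∫⁻ ω, h ω ^ r ∂μ) ^ (1 / r) := by
    rw [eLpNorm_eq_lintegral_rpow_enorm_toReal hor ENNReal.ofReal_ne_top,
      ENNReal.toReal_ofReal hr0.le, hint]
  have hmem : MemLp (fun ω => (h ω).toReal) (ENNReal.ofReal r) μ := by
    refine ⟨hh.ennreal_toReal.aestronglyMeasurable, ?_⟩
    rw [heLp]
    exact ENNReal.rpow_lt_top_of_nonneg (by positivity) hfin
  have hint1 : Integrable (fun ω => (h ω).toReal) μ := by
    refine hmem.integrable ?_
    rw [← ENNReal.ofReal_one]
    exact ENNReal.ofReal_le_ofReal hr.le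
  have key := hD r hr _ hmem
  rw [eLpNorm_eq_lintegral_rpow_enorm_toReal hor ENNReal.ofReal_ne_top,
    ENNReal.toReal_ofReal hr0.le, heLp, one_div, ENNReal.rpow_inv_le_iff hr0,
    ENNReal.mul_rpow_of_nonneg _ _ hr0.le, ENNReal.rpow_inv_rpow hr0.ne'] at key
  refine le_trans (le_of_eq (lintegral_congr_ae ?_)) key
  have hk : ∀ k, condLExp (U k) μ h =ᵐ[μ] fun ω => ‖(μ[fun ω => (h ω).toReal | U k]) ω‖ₑ :=
    fun k => ((condLExp_congr_ae hnorm).symm.trans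
      (condLExp_enorm (U k) hint1 (ae_of_all _ fun ω => ENNReal.toReal_nonneg)))
  filter_upwards [ae_all_iff.2 hk] with ω hω
  simp_rw [hω, enorm_eq_self]


/-! ### Hölder's inequality, conditional and mixed -/

theorem tsum_mul_le_Lp_mul_Lq {J : Type*} {p p' : ℝ} (hp : p.HolderConjugate p')
    (a b : J → ℝ≥0∞) :
    ∑' k, a k ^ (1 / p) * b k ^ (1 / p') ≤ (∑' k, a k) ^ (1 / p) * (∑' k, b k) ^ (1 / p') := by
  have hp0 := hp.pos
  have hp0' := hp.symm.pos
  rw [ENNReal.tsum_eq_iSup_sum]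
  refine iSup_le fun s => ?_
  refine (ENNReal.inner_le_Lp_mul_Lq s _ _ hp).trans ?_
  simp_rw [one_div, ENNReal.rpow_inv_rpow hp.ne_zero, ENNReal.rpow_inv_rpow hp.symm.ne_zero]
  gcongr
  · exact ENNReal.sum_le_tsum s
  · exact ENNReal.sum_le_tsum s

/-- Young's inequality for `(f / a) * (g * a)` with `a = (A / B)^(1/(p p'))`. In the application `A`
and `B` are the conditional expectations of `f^p` and `g^p'`; with this weight each power on the
right integrates to at most the integral of `A^(1/p) B^(1/p')`, and the coefficients `1/p` and
`1/p'` add up to 1. -/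
theorem mul_le_weighted_young {p p' : ℝ} (hp : p.HolderConjugate p') {f g A B : ℝ≥0∞}
    (hA : A ≠ ∞) (hB : B ≠ ∞) (hA0 : A = 0 → f = 0) (hB0 : B = 0 → g = 0) :
    f * g ≤ f ^ p * (A ^ (-(1 / p')) * B ^ (1 / p')) / ENNReal.ofReal p +
      g ^ p' * (B ^ (-(1 / p)) * A ^ (1 / p)) / ENNReal.ofReal p' := by
  have hp0 := hp.pos
  have hp0' := hp.symm.pos
  by_cases h0 : A = 0
  · simp [hA0 h0]
  by_cases h0' : B = 0
  · simp [hB0 h0']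
  set a : ℝ≥0∞ := A ^ (1 / (p * p')) * B ^ (-(1 / (p * p'))) with ha
  have ha0 : a ≠ 0 := by
    simp only [ha, ne_eq, mul_eq_zero, ENNReal.rpow_eq_zero_iff, h0, h0', hA, hB]
    simp
  have hat : a ≠ ∞ := ENNReal.mul_ne_top (ENNReal.rpow_ne_top_of_ne_zero h0 hA)
    (ENNReal.rpow_ne_top_of_ne_zero h0' hB)
  have hap' : a ^ p' = B ^ (-(1 / p)) * A ^ (1 / p) := by
    rw [ha, ENNReal.mul_rpow_of_nonneg _ _ hp0'.le, ← ENNReal.rpow_mul, ← ENNReal.rpow_mul,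
      mul_comm]
    congr 2 <;> field_simp
  have hap : (a⁻¹) ^ p = A ^ (-(1 / p')) * B ^ (1 / p') := by
    rw [← ENNReal.rpow_neg_one, ha, ENNReal.mul_rpow_of_ne_top (ENNReal.rpow_ne_top_of_ne_zero h0 hA)
      (ENNReal.rpow_ne_top_of_ne_zero h0' hB), ENNReal.mul_rpow_of_nonneg _ _ hp0.le]
    simp_rw [← ENNReal.rpow_mul]
    congr 2 <;> field_simp
  calc f * g = (f * a⁻¹) * (g * a) := by
        rw [mul_mul_mul_comm, ENNReal.inv_mul_cancel ha0 hat, mul_one]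
    _ ≤ _ := ENNReal.young_inequality _ _ hp
    _ = _ := by
        rw [ENNReal.mul_rpow_of_nonneg _ _ hp0.le, ENNReal.mul_rpow_of_nonneg _ _ hp0'.le, hap, hap']

theorem mul_rpow_neg_le {A : ℝ≥0∞} {s : ℝ} (hA : A ≠ ∞) :
    A * A ^ (-s) ≤ A ^ (1 - s) := by
  rcases eq_or_ne A 0 with rfl | h0
  · simp
  · rw [sub_eq_add_neg, ENNReal.rpow_add _ _ h0 hA, ENNReal.rpow_one]

/-- The set where the conditional expectation vanishes belongs to `m`, so `f` has integral 0 over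
it. This settles the degenerate weights in the conditional Hölder inequality. -/
theorem ae_eq_zero_of_condLExp_eq_zero {Ω : Type*} {m m0 : MeasurableSpace Ω} {μ : Measure Ω}
    (hm : m ≤ m0) [SigmaFinite (μ.trim hm)] {f : Ω → ℝ≥0∞} (hf : AEMeasurable f μ) :
    ∀ᵐ ω ∂μ, condLExp m μ f ω = 0 → f ω = 0 := by
  have hs : MeasurableSet[m] {ω | condLExp m μ f ω = 0} :=
    measurable_condLExp m μ f (measurableSet_singleton 0)
  have h := setLIntegral_condLExp hm μ f hs
  rw [setLIntegral_congr_fun (hm _ hs) (g := fun _ => 0) (fun ω hω => hω), lintegral_zero, eq_comm,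
    setLIntegral_eq_zero_iff' (hm _ hs) hf.restrict] at h
  exact h

/-- Hölder's inequality for conditional expectations, in integrated form. -/
theorem lintegral_mul_le_condLExp {Ω : Type*} {m m0 : MeasurableSpace Ω} {μ : Measure Ω}
    (hm : m ≤ m0) [SigmaFinite (μ.trim hm)] {p p' : ℝ} (hp : p.HolderConjugate p')
    {f g : Ω → ℝ≥0∞} (hf : AEMeasurable f μ) (hg : AEMeasurable g μ)
    (hf_fin : ∀ᵐ ω ∂μ, condLExp m μ (fun ω => f ω ^ p) ω ≠ ∞)
    (hg_fin : ∀ᵐ ω ∂μ, condLExp m μ (fun ω => g ω ^ p') ω ≠ ∞) :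
    ∫⁻ ω, f ω * g ω ∂μ ≤ ∫⁻ ω, condLExp m μ (fun ω => f ω ^ p) ω ^ (1 / p) *
      condLExp m μ (fun ω => g ω ^ p') ω ^ (1 / p') ∂μ := by
  have hp0 := hp.pos
  have hp0' := hp.symm.pos
  set A := condLExp m μ (fun ω => f ω ^ p) with hA
  set B := condLExp m μ (fun ω => g ω ^ p') with hB
  have hAm : Measurable[m] A := measurable_condLExp _ _ _
  have hBm : Measurable[m] B := measurable_condLExp _ _ _
  have hAm' : Measurable A := measurable_condLExp' _ _ _
  have hBm' : Measurable B := measurable_condLExp' _ _ _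
  -- The weight is `m`-measurable, so `f^p` may be replaced by `A` under the integral, and `A *
  -- A^(-1/p') ≤ A^(1/p)`. The claim is general because it is used a second time with `f`, `A`, `p`
  -- and `g`, `B`, `p'` exchanged.
  have half : ∀ {p p' : ℝ}, p.HolderConjugate p' → ∀ {f : Ω → ℝ≥0∞} {A B : Ω → ℝ≥0∞},
      AEMeasurable f μ → Measurable[m] B → A = condLExp m μ (fun ω => f ω ^ p) →
      (∀ᵐ ω ∂μ, A ω ≠ ∞) →
      ∫⁻ ω, f ω ^ p * (A ω ^ (-(1 / p')) * B ω ^ (1 / p')) ∂μ ≤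
        ∫⁻ ω, A ω ^ (1 / p) * B ω ^ (1 / p') ∂μ := by
    intro p p' hp f A B hf hB hA hfin
    have hAm : Measurable[m] A := hA ▸ measurable_condLExp _ _ _
    have h := lintegral_mul_condLExp hm (hf.pow_const p)
      ((hAm.pow_const (-(1 / p'))).mul (hB.pow_const (1 / p')))
    simp_rw [mul_comm (f _ ^ p)]
    refine h.symm.le.trans (lintegral_mono_ae ?_)
    filter_upwards [hfin] with ω hω
    rw [← hA, Pi.mul_apply, mul_right_comm, mul_comm (A ω ^ _)]
    gcongr
    refine (mul_rpow_neg_le hω).trans_eq ?_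
    rw [one_div, one_div, hp.symm.one_sub_inv]
  have h1 := half hp hf hBm hA hf_fin
  have h2 := half hp.symm hg hAm hB hg_fin
  have hpt : ∀ᵐ ω ∂μ, f ω * g ω ≤
      f ω ^ p * (A ω ^ (-(1 / p')) * B ω ^ (1 / p')) / ENNReal.ofReal p +
      g ω ^ p' * (B ω ^ (-(1 / p)) * A ω ^ (1 / p)) / ENNReal.ofReal p' := by
    filter_upwards [hf_fin, hg_fin, ae_eq_zero_of_condLExp_eq_zero hm (hf.pow_const p),
      ae_eq_zero_of_condLExp_eq_zero hm (hg.pow_const p')] with ω h1 h2 h3 h4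
    refine mul_le_weighted_young hp h1 h2 (fun h => ?_) fun h => ?_
    · simpa [hp0, hp0.not_gt] using h3 h
    · simpa [hp0', hp0'.not_gt] using h4 h
  have hI : ∫⁻ ω, B ω ^ (1 / p') * A ω ^ (1 / p) ∂μ = ∫⁻ ω, A ω ^ (1 / p) * B ω ^ (1 / p') ∂μ := by
    simp_rw [mul_comm]
  rw [hI] at h2
  refine (lintegral_mono_ae hpt).trans ?_
  simp_rw [div_eq_mul_inv _ (ENNReal.ofReal _)]
  rw [lintegral_add_left' (by fun_prop), lintegral_mul_const'' _ (by fun_prop),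
    lintegral_mul_const'' _ (by fun_prop)]
  refine (add_le_add (mul_le_mul_left h1 _) (mul_le_mul_left h2 _)).trans_eq ?_
  rw [← mul_add, ← ENNReal.ofReal_inv_of_pos hp0, ← ENNReal.ofReal_inv_of_pos hp0',
    ← ENNReal.ofReal_add (by positivity) (by positivity), hp.inv_add_inv_eq_one, ENNReal.ofReal_one,
    mul_one]

section

variable {Ω J : Type*} {m0 : MeasurableSpace Ω} {μ : Measure Ω}
  {U : J → MeasurableSpace Ω} {p q : ℝ}

theorem measurable_tsum_condLExp [Countable J] (f : J → Ω → ℝ≥0∞) :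
    Measurable fun ω => ∑' k, condLExp (U k) μ (f k) ω :=
  Measurable.tsum fun _ => measurable_condLExp' _ _ _

theorem lintegral_rpow_ne_top_of_condMixedENorm (hq : 1 ≤ q) {X : J → Ω → ℝ}
    (h : condMixedENorm μ U p q X < ∞) :
    ∫⁻ ω, (∑' k, condLExp (U k) μ (fun ω' => ‖X k ω'‖ₑ ^ p) ω) ^ (q / p) ∂μ ≠ ∞ := by
  have hq0 : 0 < q := by linarith
  intro h'
  rw [condMixedENorm, h', ENNReal.top_rpow_of_pos (by positivity)] at h
  exact lt_irrefl _ h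

theorem ae_tsum_condLExp_ne_top [Countable J] (hp : 1 ≤ p) (hq : 1 ≤ q) {X : J → Ω → ℝ}
    (h : condMixedENorm μ U p q X < ∞) :
    ∀ᵐ ω ∂μ, ∑' k, condLExp (U k) μ (fun ω' => ‖X k ω'‖ₑ ^ p) ω ≠ ∞ := by
  have hp0 : 0 < p := by linarith
  have hq0 : 0 < q := by linarith
  filter_upwards [ae_lt_top ((measurable_tsum_condLExp _).pow_const _)
    (lintegral_rpow_ne_top_of_condMixedENorm hq h)] with ω hω htop
  rw [htop, ENNReal.top_rpow_of_pos (by positivity)] at hω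
  exact lt_irrefl _ hω

theorem ae_condLExp_ne_top [Countable J] (hp : 1 ≤ p) (hq : 1 ≤ q) {X : J → Ω → ℝ}
    (h : condMixedENorm μ U p q X < ∞) (k : J) :
    ∀ᵐ ω ∂μ, condLExp (U k) μ (fun ω' => ‖X k ω'‖ₑ ^ p) ω ≠ ∞ := by
  filter_upwards [ae_tsum_condLExp_ne_top hp hq h] with ω hω
  exact ENNReal.ne_top_of_tsum_ne_top hω k

/-- Hölder's inequality for the conditional mixed norms. -/
theorem tsum_lintegral_mul_le [Countable J] [IsProbabilityMeasure μ] {p' q' : ℝ} (hU : ∀ k, U k ≤ m0)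
    (hp : p.HolderConjugate p') (hq : q.HolderConjugate q') {X Y : J → Ω → ℝ}
    (hX : ∀ k, AEMeasurable (X k) μ) (hY : ∀ k, AEMeasurable (Y k) μ)
    (hX' : condMixedENorm μ U p q X < ∞) (hY' : condMixedENorm μ U p' q' Y < ∞) :
    ∑' k, ∫⁻ ω, ‖X k ω * Y k ω‖ₑ ∂μ ≤ condMixedENorm μ U p q X * condMixedENorm μ U p' q' Y := by
  have hp0 := hp.pos
  have hp0' := hp.symm.pos
  have hq0 := hq.pos
  have hq0' := hq.symm.pos
  simp_rw [enorm_mul]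
  calc ∑' k, ∫⁻ ω, ‖X k ω‖ₑ * ‖Y k ω‖ₑ ∂μ
      ≤ ∑' k, ∫⁻ ω, condLExp (U k) μ (fun ω' => ‖X k ω'‖ₑ ^ p) ω ^ (1 / p) *
          condLExp (U k) μ (fun ω' => ‖Y k ω'‖ₑ ^ p') ω ^ (1 / p') ∂μ := by
        refine ENNReal.tsum_le_tsum fun k => ?_
        exact lintegral_mul_le_condLExp (hU k) hp (hX k).enorm (hY k).enorm
          (ae_condLExp_ne_top hp.lt.le hq.lt.le hX' k)
          (ae_condLExp_ne_top hp.symm.lt.le hq.symm.lt.le hY' k)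
    _ = ∫⁻ ω, ∑' k, condLExp (U k) μ (fun ω' => ‖X k ω'‖ₑ ^ p) ω ^ (1 / p) *
          condLExp (U k) μ (fun ω' => ‖Y k ω'‖ₑ ^ p') ω ^ (1 / p') ∂μ := by
        exact (lintegral_tsum fun k => (((measurable_condLExp' _ _ _).pow_const _).mul
          ((measurable_condLExp' _ _ _).pow_const _)).aemeasurable).symm
    _ ≤ ∫⁻ ω, (∑' k, condLExp (U k) μ (fun ω' => ‖X k ω'‖ₑ ^ p) ω) ^ (1 / p) *
          (∑' k, condLExp (U k) μ (fun ω' => ‖Y k ω'‖ₑ ^ p') ω) ^ (1 / p') ∂μ :=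
        lintegral_mono fun ω => tsum_mul_le_Lp_mul_Lq hp _ _
    _ ≤ _ := ENNReal.lintegral_mul_le_Lp_mul_Lq μ hq
        ((measurable_tsum_condLExp _).pow_const _).aemeasurable
        ((measurable_tsum_condLExp _).pow_const _).aemeasurable
    _ = _ := by
        simp_rw [← ENNReal.rpow_mul, one_div_mul_eq_div]
        rfl

end


/-! ### Dominated convergence and finiteness for the mixed norm -/

theorem exists_simpleFunc_tendsto {Ω : Type*} [MeasurableSpace Ω] {g : Ω → ℝ} (hg : Measurable g) :
    ∃ f : ℕ → SimpleFunc Ω ℝ, (∀ n ω, ‖f n ω‖ ≤ ‖g ω‖ + ‖g ω‖) ∧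
      ∀ ω, Tendsto (fun n => f n ω) atTop (𝓝 (g ω)) :=
  ⟨fun n => SimpleFunc.approxOn g hg Set.univ 0 (Set.mem_univ 0) n,
    fun n ω => SimpleFunc.norm_approxOn_zero_le hg (Set.mem_univ 0) ω n,
    fun _ => SimpleFunc.tendsto_approxOn hg (Set.mem_univ 0) (by simp)⟩

theorem tendsto_tsum_zero_of_dominated {J : Type*} [Countable J] {f : ℕ → J → ℝ≥0∞}
    {g : J → ℝ≥0∞} (hfg : ∀ n k, f n k ≤ g k) (hg : ∑' k, g k ≠ ∞)
    (hlim : ∀ k, Tendsto (fun n => f n k) atTop (𝓝 0)) :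
    Tendsto (fun n => ∑' k, f n k) atTop (𝓝 0) := by
  -- The sum is an integral against the counting measure.
  let _ : MeasurableSpace J := ⊤
  have h := tendsto_lintegral_of_dominated_convergence (μ := Measure.count) (F := f) (f := fun _ => 0)
    g (fun n => measurable_from_top) (fun n => ae_of_all _ (hfg n))
    (by rwa [lintegral_count]) (ae_of_all _ hlim)
  simpa [lintegral_count] using h

/-- The dominated convergence theorem for the conditional mixed norm. -/
theorem tendsto_condMixedENorm_zero {Ω J : Type*} [Countable J] {m0 : MeasurableSpace Ω}
    {μ : Measure Ω} [IsProbabilityMeasure μ] {U : J → MeasurableSpace Ω} {p q : ℝ}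
    (hU : ∀ k, U k ≤ m0) (hp : 1 ≤ p) (hq : 1 ≤ q) {X : ℕ → J → Ω → ℝ} {Z : J → Ω → ℝ}
    (hX : ∀ n k, AEMeasurable (X n k) μ) (hZ : ∀ k, AEMeasurable (Z k) μ)
    (hZ_fin : condMixedENorm μ U p q Z < ∞) (hle : ∀ n k, ∀ᵐ ω ∂μ, ‖X n k ω‖ₑ ≤ ‖Z k ω‖ₑ)
    (hlim : ∀ k, ∀ᵐ ω ∂μ, Tendsto (fun n => X n k ω) atTop (𝓝 0)) :
    Tendsto (fun n => condMixedENorm μ U p q (X n)) atTop (𝓝 0) := by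
  have hp0 : 0 < p := by linarith
  have hq0 : 0 < q := by linarith
  have hzero : ∀ {s : ℝ}, 0 < s → Tendsto (fun x : ℝ≥0∞ => x ^ s) (𝓝 0) (𝓝 0) := fun {s} hs => by
    simpa [hs] using (ENNReal.continuous_rpow_const (y := s)).tendsto 0
  have hleE : ∀ n k, condLExp (U k) μ (fun ω => ‖X n k ω‖ₑ ^ p) ≤ᵐ[μ]
      condLExp (U k) μ (fun ω => ‖Z k ω‖ₑ ^ p) := fun n k => by
    refine condLExp_mono ?_
    filter_upwards [hle n k] with ω hω
    exact ENNReal.rpow_le_rpow hω hp0.le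
  have hleE' : ∀ᵐ ω ∂μ, ∀ n k, condLExp (U k) μ (fun ω => ‖X n k ω‖ₑ ^ p) ω ≤
      condLExp (U k) μ (fun ω => ‖Z k ω‖ₑ ^ p) ω := by
    simp_rw [ae_all_iff]
    exact hleE
  have hlimE : ∀ᵐ ω ∂μ, ∀ k,
      Tendsto (fun n => condLExp (U k) μ (fun ω => ‖X n k ω‖ₑ ^ p) ω) atTop (𝓝 0) := by
    rw [ae_all_iff]
    intro k
    refine tendsto_condLExp_zero (g := fun ω => ‖Z k ω‖ₑ ^ p) (hU k)
      (fun n => (hX n k).enorm.pow_const p) ((hZ k).enorm.pow_const p) (fun n => ?_) ?_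
      (ae_condLExp_ne_top hp hq hZ_fin k) ?_
    · filter_upwards [hle n k] with ω hω
      exact ENNReal.rpow_le_rpow hω hp0.le
    · exact ae_of_all _ fun ω => ENNReal.rpow_ne_top_of_nonneg hp0.le enorm_ne_top
    · filter_upwards [hlim k] with ω hω
      refine (hzero hp0).comp ?_
      simpa using hω.enorm
  have hfinZ := lintegral_rpow_ne_top_of_condMixedENorm hq hZ_fin
  unfold condMixedENorm
  refine (hzero (s := 1 / q) (by positivity)).comp ?_
  have h := tendsto_lintegral_of_dominated_convergence (μ := μ)
    (F := fun n ω => (∑' k, condLExp (U k) μ (fun ω' => ‖X n k ω'‖ₑ ^ p) ω) ^ (q / p))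
    (f := fun _ => 0) _ (fun n => (measurable_tsum_condLExp _).pow_const _) (fun n => ?_) hfinZ ?_
  · simpa using h
  · filter_upwards [hleE'] with ω hω
    exact ENNReal.rpow_le_rpow (ENNReal.tsum_le_tsum fun k => hω n k) (by positivity)
  · filter_upwards [hleE', hlimE, ae_tsum_condLExp_ne_top hp hq hZ_fin] with ω h1 h2 h3
    exact (hzero (by positivity)).comp (tendsto_tsum_zero_of_dominated h1 h3 h2)

theorem condMixedENorm_mono {Ω J : Type*} [Countable J] {m0 : MeasurableSpace Ω} {μ : Measure Ω}
    {U : J → MeasurableSpace Ω} {p q : ℝ} (hp : 1 ≤ p) (hq : 1 ≤ q) {X Y : J → Ω → ℝ}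
    (h : ∀ k, ∀ᵐ ω ∂μ, ‖X k ω‖ₑ ≤ ‖Y k ω‖ₑ) :
    condMixedENorm μ U p q X ≤ condMixedENorm μ U p q Y := by
  have hp0 : 0 < p := by linarith
  have hq0 : 0 < q := by linarith
  have hleE : ∀ k, condLExp (U k) μ (fun ω => ‖X k ω‖ₑ ^ p) ≤ᵐ[μ]
      condLExp (U k) μ (fun ω => ‖Y k ω‖ₑ ^ p) := fun k => by
    refine condLExp_mono ?_
    filter_upwards [h k] with ω hω
    exact ENNReal.rpow_le_rpow hω hp0.le
  unfold condMixedENorm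
  refine ENNReal.rpow_le_rpow (lintegral_mono_ae ?_) (by positivity)
  filter_upwards [ae_all_iff.2 hleE] with ω hω
  exact ENNReal.rpow_le_rpow (ENNReal.tsum_le_tsum hω) (by positivity)

theorem condMixedENorm_lt_top_of_bounded {Ω J : Type*} {m0 : MeasurableSpace Ω}
    {μ : Measure Ω} [IsProbabilityMeasure μ] {U : J → MeasurableSpace Ω} {p q : ℝ}
    (hU : ∀ k, U k ≤ m0) (hp : 1 ≤ p) (hq : 1 ≤ q) {X : J → Ω → ℝ} (s : Finset J)
    (hX : ∀ k, k ∉ s → X k = 0) {c : ℝ≥0} (hc : ∀ k ω, ‖X k ω‖ₑ ≤ c) :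
    condMixedENorm μ U p q X < ∞ := by
  have hp0 : 0 < p := by linarith
  have hq0 : 0 < q := by linarith
  have h0 : ∀ k, k ∉ s → condLExp (U k) μ (fun ω' => ‖X k ω'‖ₑ ^ p) = 0 := fun k hk => by
    rw [hX k hk]
    simp [hp0, ← Pi.zero_def]
  have hcp : (∑ _k ∈ s, (c : ℝ≥0∞) ^ p) ^ (q / p) ≠ ∞ := by
    refine ENNReal.rpow_ne_top_of_nonneg (by positivity) ?_
    exact ENNReal.sum_ne_top.2 fun _ _ =>
      ENNReal.rpow_ne_top_of_nonneg hp0.le ENNReal.coe_ne_top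
  have hle : ∀ k ∈ s, condLExp (U k) μ (fun ω' => ‖X k ω'‖ₑ ^ p) ≤ᵐ[μ]
      fun _ => (c : ℝ≥0∞) ^ p := fun k _ => by
    rw [← condLExp_const (hU k) μ]
    exact condLExp_mono (ae_of_all _ fun ω => ENNReal.rpow_le_rpow (hc k ω) hp0.le)
  refine ENNReal.rpow_lt_top_of_nonneg (by positivity) (ne_top_of_le_ne_top hcp ?_)
  calc _ ≤ ∫⁻ _, (∑ _k ∈ s, (c : ℝ≥0∞) ^ p) ^ (q / p) ∂μ := by
        refine lintegral_mono_ae ?_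
        filter_upwards [(Finset.eventually_all s).2 hle] with ω hω
        rw [tsum_eq_sum fun k hk => by rw [h0 k hk]; rfl]
        exact ENNReal.rpow_le_rpow (Finset.sum_le_sum hω) (by positivity)
    _ = _ := by simp

end CondMixed

/-! ### Coordinates, indicator families and their density -/

namespace CondMixedLp

open Filter Topology

variable {Ω J : Type*} [Countable J] {m0 : MeasurableSpace Ω} {μ : Measure Ω}
  {V U : J → MeasurableSpace Ω} {hU : ∀ k, U k ≤ m0} {p q : ℝ} {hp : 1 ≤ p} {hq : 1 ≤ q}

theorem aestronglyMeasurable_coord (X : CondMixedLp μ V U hU hp hq) (k : J) :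
    AEStronglyMeasurable[V k] (X.coord k) μ :=
  X.2.1 k

theorem condMixedENorm_coord_lt_top (X : CondMixedLp μ V U hU hp hq) :
    condMixedENorm μ U p q (fun k => X.coord k) < ∞ :=
  X.2.2

theorem coord_add (X Y : CondMixedLp μ V U hU hp hq) (k : J) :
    (X + Y).coord k =ᵐ[μ] X.coord k + Y.coord k :=
  AEEqFun.coeFn_add (X.coord k) (Y.coord k)

theorem coord_sub (X Y : CondMixedLp μ V U hU hp hq) (k : J) :
    (X - Y).coord k =ᵐ[μ] X.coord k - Y.coord k :=
  AEEqFun.coeFn_sub (X.coord k) (Y.coord k)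

theorem coord_smul (c : ℝ) (X : CondMixedLp μ V U hU hp hq) (k : J) :
    (c • X).coord k =ᵐ[μ] c • (X.coord k : Ω → ℝ) :=
  AEEqFun.coeFn_smul c (X.coord k)

theorem coord_zero (k : J) : (0 : CondMixedLp μ V U hU hp hq).coord k =ᵐ[μ] (0 : Ω → ℝ) :=
  AEEqFun.coeFn_zero

theorem ext_coord {X Y : CondMixedLp μ V U hU hp hq} (h : ∀ k, X.coord k =ᵐ[μ] Y.coord k) :
    X = Y :=
  Subtype.ext (funext fun k => AEEqFun.ext (h k))

theorem exists_coord_eq (hV : ∀ k, V k ≤ m0) {X : J → Ω → ℝ}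
    (hX : ∀ k, AEStronglyMeasurable[V k] (X k) μ) (h : condMixedENorm μ U p q X < ∞) :
    ∃ Z : CondMixedLp μ V U hU hp hq, ∀ k, Z.coord k =ᵐ[μ] X k := by
  have hmk : ∀ k, AEEqFun.mk (X k) ((hX k).mono (hV k)) =ᵐ[μ] X k := fun k => AEEqFun.coeFn_mk _ _
  refine ⟨⟨fun k => AEEqFun.mk (X k) ((hX k).mono (hV k)), fun k => (hX k).congr (hmk k).symm, ?_⟩,
    hmk⟩
  rwa [CondMixed.condMixedENorm_congr hmk]

variable [IsProbabilityMeasure μ]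

theorem enorm_eq (X : CondMixedLp μ V U hU hp hq) :
    ‖X‖ₑ = condMixedENorm μ U p q (fun k => X.coord k) := by
  rw [← ofReal_norm, norm_def, ENNReal.ofReal_toReal X.condMixedENorm_coord_lt_top.ne]

theorem exists_coord_eq_single (hV : ∀ k, V k ≤ m0) (k : J) {f : Ω → ℝ}
    (hf : StronglyMeasurable[V k] f) {c : ℝ≥0} (hc : ∀ ω, ‖f ω‖ₑ ≤ c) :
    ∃ Z : CondMixedLp μ V U hU hp hq, Z.coord k =ᵐ[μ] f ∧
      ∀ j, j ≠ k → Z.coord j =ᵐ[μ] (0 : Ω → ℝ) := by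
  classical
  have hX : ∀ j, AEStronglyMeasurable[V j] ((Pi.single k f : J → Ω → ℝ) j) μ := fun j => by
    rcases eq_or_ne j k with rfl | hj
    · simpa using hf.aestronglyMeasurable
    · have h : (Pi.single k f : J → Ω → ℝ) j = fun _ => 0 := by simp [hj, Pi.zero_def]
      rw [h]
      exact aestronglyMeasurable_const
  obtain ⟨Z, hZ⟩ := exists_coord_eq (hU := hU) (hp := hp) (hq := hq) (μ := μ) hV hX
    (CondMixed.condMixedENorm_lt_top_of_bounded hU hp hq {k}
      (fun j hj => by simp [Finset.notMem_singleton.1 hj]) (c := c) fun j ω => by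
        rcases eq_or_ne j k with rfl | hj
        · simpa using hc ω
        · simp [hj])
  refine ⟨Z, by simpa using hZ k, fun j hj => ?_⟩
  have h := hZ j
  simpa [hj] using h

/-- `Z` is the family whose only non-zero random variable is the indicator of `A` at `k`. -/
def IsIndicator (Z : CondMixedLp μ V U hU hp hq) (k : J) (A : Set Ω) : Prop :=
  Z.coord k =ᵐ[μ] A.indicator (fun _ => (1 : ℝ)) ∧ ∀ j, j ≠ k → Z.coord j =ᵐ[μ] (0 : Ω → ℝ)

theorem exists_isIndicator (hV : ∀ k, V k ≤ m0) (k : J) {A : Set Ω} (hA : MeasurableSet[V k] A) :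
    ∃ Z : CondMixedLp μ V U hU hp hq, Z.IsIndicator k A :=
  exists_coord_eq_single hV k (c := 1) (stronglyMeasurable_const.indicator hA) fun ω => by
    by_cases h : ω ∈ A <;> simp [h]

/-- Families with one simple coordinate are finite linear combinations of indicator families, and
`ψ` is linear. -/
theorem apply_eq_zero_of_simpleFunc (hV : ∀ k, V k ≤ m0)
    {ψ : StrongDual ℝ (CondMixedLp μ V U hU hp hq)}
    (hψ : ∀ k A, MeasurableSet[V k] A → ∀ Z, IsIndicator Z k A → ψ Z = 0) (k : J)
    (f : @SimpleFunc Ω (V k) ℝ) (Z : CondMixedLp μ V U hU hp hq) (hZ : Z.coord k =ᵐ[μ] f)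
    (hZ' : ∀ j, j ≠ k → Z.coord j =ᵐ[μ] (0 : Ω → ℝ)) : ψ Z = 0 := by
  induction f using SimpleFunc.induction generalizing Z with
  | @const c A hA =>
    rcases eq_or_ne c 0 with rfl | hc
    · have : Z = 0 := ext_coord fun j => by
        rcases eq_or_ne j k with rfl | hj
        · filter_upwards [hZ, coord_zero (V := V) (hU := hU) (hp := hp) (hq := hq) j] with ω h1 h2
          rw [h1, h2]
          simp
        · exact (hZ' j hj).trans (coord_zero j).symm
      rw [this, map_zero]
    · have : ψ (c⁻¹ • Z) = 0 := by
        refine hψ k A hA _ ⟨?_, fun j hj => ?_⟩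
        · filter_upwards [coord_smul c⁻¹ Z k, hZ] with ω h1 h2
          rw [h1, Pi.smul_apply, h2]
          by_cases h : ω ∈ A <;> simp [h, hc]
        · filter_upwards [coord_smul c⁻¹ Z j, hZ' j hj] with ω h1 h2
          rw [h1, Pi.smul_apply, h2]
          simp
      simpa [hc] using this
  | @add f g _ ihf ihg =>
    obtain ⟨C, hC⟩ := @SimpleFunc.exists_forall_norm_le Ω ℝ (V k) _ f
    obtain ⟨Zf, hZf, hZf'⟩ := exists_coord_eq_single (hU := hU) (hp := hp) (hq := hq) (μ := μ) hV k
      (@SimpleFunc.stronglyMeasurable Ω ℝ (V k) _ f) (c := C.toNNReal) fun ω => by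
        rw [← ofReal_norm]
        exact ENNReal.ofReal_le_ofReal (hC ω)
    have h1 : ψ Zf = 0 := ihf Zf hZf hZf'
    have h2 : ψ (Z - Zf) = 0 := by
      refine ihg _ ?_ fun j hj => ?_
      · filter_upwards [coord_sub Z Zf k, hZ, hZf] with ω h1 h2 h3
        rw [h1, Pi.sub_apply, h2, h3]
        simp
      · filter_upwards [coord_sub Z Zf j, hZ' j hj, hZf' j hj] with ω h1 h2 h3
        rw [h1, Pi.sub_apply, h2, h3]
        simp
    simpa [h1] using h2

/-- The indicator families span a dense subspace. -/
theorem strongDual_ext (hV : ∀ k, V k ≤ m0)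
    {ψ : StrongDual ℝ (CondMixedLp μ V U hU hp hq)}
    (hψ : ∀ k A, MeasurableSet[V k] A → ∀ Z, IsIndicator Z k A → ψ Z = 0) : ψ = 0 := by
  classical
  ext Z
  have hrep := fun k => Z.aestronglyMeasurable_coord k
  choose g hg hgZ using hrep
  -- Numbering `J` lets the `n`-th approximation keep only the finitely many coordinates with `e k ≤
  -- n`.
  obtain ⟨e, he⟩ := exists_injective_nat J
  choose f hfle hflim using fun k =>
    @CondMixed.exists_simpleFunc_tendsto Ω (V k) (g k) (hg k).measurable
  have hW : ∀ n (s : Finset J), ∃ W : CondMixedLp μ V U hU hp hq, ψ W = 0 ∧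
      ∀ k, W.coord k =ᵐ[μ] if k ∈ s then ⇑(f k n) else 0 := by
    intro n s
    induction s using Finset.induction_on with
    | empty => exact ⟨0, map_zero _, fun k => by simpa using coord_zero k⟩
    | insert a s ha ih =>
      obtain ⟨W, hW0, hW⟩ := ih
      obtain ⟨C, hC⟩ := @SimpleFunc.exists_forall_norm_le Ω ℝ (V a) _ (f a n)
      obtain ⟨Za, hZa, hZa'⟩ := exists_coord_eq_single (hU := hU) (hp := hp) (hq := hq) (μ := μ) hV
        a (@SimpleFunc.stronglyMeasurable Ω ℝ (V a) _ (f a n)) (c := C.toNNReal) fun ω => by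
          rw [← ofReal_norm]
          exact ENNReal.ofReal_le_ofReal (hC ω)
      refine ⟨W + Za, ?_, fun k => ?_⟩
      · rw [map_add, hW0, apply_eq_zero_of_simpleFunc hV hψ a (f a n) Za hZa hZa', add_zero]
      · rcases eq_or_ne k a with rfl | hk
        · filter_upwards [coord_add W Za k, hW k, hZa] with ω h1 h2 h3
          rw [h1, Pi.add_apply, h2, h3]
          simp [ha]
        · filter_upwards [coord_add W Za k, hW k, hZa' k hk] with ω h1 h2 h3
          rw [h1, Pi.add_apply, h2, h3]
          simp [hk]
  have hs : ∀ n, {k | e k ≤ n}.Finite := fun n => (Set.finite_Iic n).preimage he.injOn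
  choose W hW0 hWc using fun n => hW n (hs n).toFinset
  have hlim : Tendsto (fun n => ‖W n - Z‖ₑ) atTop (𝓝 0) := by
    simp_rw [enorm_eq]
    -- The approximating simple functions are bounded by twice `|Z_k|`, hence the error by three
    -- times `|Z_k|`.
    refine CondMixed.tendsto_condMixedENorm_zero hU hp hq (Z := fun k ω => 3 * Z.coord k ω)
      (fun n k => ((W n - Z).coord k).aemeasurable)
      (fun k => (Z.coord k).aemeasurable.const_mul 3) ?_ (fun n k => ?_) fun k => ?_
    · rw [CondMixed.condMixedENorm_smul hp hq]
      exact ENNReal.mul_lt_top enorm_lt_top Z.condMixedENorm_coord_lt_top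
    · filter_upwards [coord_sub (W n) Z k, hWc n k, hgZ k] with ω h1 h2 h3
      rw [h1, Pi.sub_apply, h2, h3, ← ofReal_norm, ← ofReal_norm, norm_mul]
      refine ENNReal.ofReal_le_ofReal ?_
      have := hfle k n ω
      refine (norm_sub_le _ _).trans ?_
      rw [Real.norm_ofNat]
      split_ifs
      · linarith
      · simp only [Pi.zero_apply, norm_zero]
        linarith [norm_nonneg (g k ω)]
    · filter_upwards [ae_all_iff.2 fun n => coord_sub (W n) Z k, ae_all_iff.2 fun n => hWc n k,
        hgZ k] with ω h1 h2 h3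
      have : Tendsto (fun n => f k n ω - g k ω) atTop (𝓝 0) := by
        simpa using (hflim k ω).sub_const (g k ω)
      refine this.congr' ?_
      filter_upwards [eventually_ge_atTop (e k)] with n hn
      rw [h1, Pi.sub_apply, h2, h3, if_pos (by simpa using hn)]
  have hWZ : Tendsto W atTop (𝓝 Z) := by
    rw [tendsto_iff_edist_tendsto_0]
    simpa [edist_eq_enorm_sub] using hlim
  have h := (ψ.continuous.tendsto Z).comp hWZ
  refine tendsto_nhds_unique h ?_
  simp [Function.comp_def, hW0]

end CondMixedLp

/-! ### Exponents and the weighted maximal estimate -/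

namespace CondMixed

open Filter Topology

section Exponents

variable {p p' q q' : ℝ}

theorem conj_lt_conj (hp : p.HolderConjugate p') (hq : q.HolderConjugate q') (h : q < p) :
    p' < q' := by
  have h1 : p⁻¹ < q⁻¹ := inv_strictAnti₀ hq.pos h
  have h2 := hp.inv_add_inv_eq_one
  have h3 := hq.inv_add_inv_eq_one
  exact (inv_lt_inv₀ hq.symm.pos hp.symm.pos).1 (by linarith)

/-- These are the exponents for Hölder's inequality applied to `M^q * S^(q/p)`: the first turns
`M^q` into `M^r` with `r = q'/(q' - p')`, the second turns `S^(q/p)` into `S^(q'/p')`. -/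
theorem holderConjugate_maximal (hp : p.HolderConjugate p') (hq : q.HolderConjugate q')
    (h : q < p) : (q' / (q' - p') / q).HolderConjugate (q' * p / (p' * q)) := by
  have hlt := sub_pos.2 (conj_lt_conj hp hq h)
  have hp0 := hp.pos
  have hp0' := hp.symm.pos
  have hq0 := hq.pos
  have hq0' := hq.symm.pos
  have hp1 := hp.sub_one_pos
  have hq1 := hq.sub_one_pos
  have hsum : (q' / (q' - p') / q)⁻¹ + (q' * p / (p' * q))⁻¹ = 1 := by
    rw [inv_div, inv_div, div_div_eq_mul_div, hp.conjugate_eq, hq.conjugate_eq]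
    field_simp
    ring
  have h1 : 0 < q' / (q' - p') / q := by positivity
  have h2 : 0 < q' * p / (p' * q) := by positivity
  refine (Real.holderConjugate_iff).2 ⟨?_, hsum⟩
  have := inv_pos.2 h2
  exact (one_lt_inv₀ (inv_pos.2 h1)).2 (by linarith) |>.trans_eq (inv_inv _)

end Exponents

/-- The product is `sgn(y) |y|^(s-1)`; at `y = 0` the first factor makes the value of `|y|^(s-2)`
irrelevant. -/
theorem enorm_mul_abs_rpow {s : ℝ} (hs : 1 < s) (y : ℝ) :
    ‖y * |y| ^ (s - 2)‖ₑ = ‖y‖ₑ ^ (s - 1) := by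
  rcases eq_or_ne y 0 with rfl | hy
  · simp [hs]
  · have hy' : 0 < |y| := abs_pos.2 hy
    rw [← ofReal_norm, ← ofReal_norm, ENNReal.ofReal_rpow_of_pos (norm_pos_iff.2 hy), norm_mul,
      Real.norm_eq_abs, Real.norm_eq_abs, abs_of_pos (Real.rpow_pos_of_pos hy' _)]
    congr 1
    rw [show s - 1 = 1 + (s - 2) by ring, Real.rpow_add hy', Real.rpow_one]

section Weight

variable {Ω J : Type*} [Countable J] {m0 : MeasurableSpace Ω} {μ : Measure Ω}
  [IsProbabilityMeasure μ] {U : J → MeasurableSpace Ω} {D : ℝ → ℝ≥0} {p p' q q' : ℝ}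

/-- Since `q' / p' ≥ 1`, the bound `x^(q'/p' - 1) ≤ 1 + x^(q'/p')` holds, and `μ` is a probability
measure. It makes the conditional expectations of `S^(q'/p' - 1)` finite almost everywhere. -/
theorem lintegral_rpow_sub_one_ne_top (hp : p.HolderConjugate p') (hq : q.HolderConjugate q')
    (hqp : q ≤ p) {S : Ω → ℝ≥0∞} (hfin : ∫⁻ ω, S ω ^ (q' / p') ∂μ ≠ ∞) :
    ∫⁻ ω, S ω ^ (q' / p' - 1) ∂μ ≠ ∞ := by
  have hp0' := hp.symm.pos
  have hle : p' ≤ q' := by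
    rcases hqp.lt_or_eq with h | rfl
    · exact (conj_lt_conj hp hq h).le
    · exact (hp.conjugate_eq.trans hq.conjugate_eq.symm).le
  have h1 : 1 ≤ q' / p' := (one_le_div hp0').2 hle
  have hpt : ∀ x : ℝ≥0∞, x ^ (q' / p' - 1) ≤ 1 + x ^ (q' / p') := fun x => by
    rcases le_total x 1 with hx | hx
    · exact (ENNReal.rpow_le_one hx (by linarith)).trans le_self_add
    · exact (ENNReal.rpow_le_rpow_of_exponent_le hx (by linarith)).trans le_add_self
  refine ne_top_of_le_ne_top ?_ (lintegral_mono fun ω => hpt (S ω))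
  rw [lintegral_add_left measurable_const]
  simpa using hfin

/-- For `q < p`, Hölder's inequality separates the maximal function from `S`, and the exponent `r =
q'/(q' - p')` of the maximal inequality is the one for which `(S^(q'/p' - 1))^r = S^(q'/p')`. Both
factors are then powers of the same integral, with exponents adding up to 1. -/
theorem lintegral_iSup_condLExp_weight_le (hD : HasDoobProperty μ U D) (hU : ∀ k, U k ≤ m0)
    (hp : p.HolderConjugate p') (hq : q.HolderConjugate q') (hqp : q ≤ p) {S : Ω → ℝ≥0∞}
    (hS : Measurable S) (hfin : ∫⁻ ω, S ω ^ (q' / p') ∂μ ≠ ∞) :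
    ∫⁻ ω, (⨆ k, condLExp (U k) μ (fun ω => S ω ^ (q' / p' - 1)) ω) ^ q * S ω ^ (q / p) ∂μ ≤
      (max 1 (D (q' / (q' - p'))) : ℝ≥0) ^ q * ∫⁻ ω, S ω ^ (q' / p') ∂μ := by
  have hp0 := hp.pos
  have hp0' := hp.symm.pos
  have hq0 := hq.pos
  have hq0' := hq.symm.pos
  rcases hqp.lt_or_eq with h | rfl
  · have hlt := sub_pos.2 (conj_lt_conj hp hq h)
    set r := q' / (q' - p') with hr
    have hr1 : 1 < r := (one_lt_div hlt).2 (by linarith)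
    have hr0 : 0 < r := by linarith
    have hκ := holderConjugate_maximal hp hq h
    set I := ∫⁻ ω, S ω ^ (q' / p') ∂μ with hI
    have hexp : ∀ ω, (S ω ^ (q' / p' - 1)) ^ r = S ω ^ (q' / p') := fun ω => by
      rw [← ENNReal.rpow_mul]
      congr 1
      rw [hr]
      field_simp
    have hdoob := lintegral_iSup_condLExp_rpow_le hD hr1 (hS.pow_const (q' / p' - 1)).aemeasurable
      (by simpa only [hexp] using hfin)
    simp_rw [hexp] at hdoob
    rw [← hI] at hdoob
    set M : Ω → ℝ≥0∞ := fun ω => ⨆ k, condLExp (U k) μ (fun ω => S ω ^ (q' / p' - 1)) ω with hM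
    have hMm : Measurable M := Measurable.iSup fun k => measurable_condLExp' _ _ _
    have hhol : ∫⁻ ω, M ω ^ q * S ω ^ (q / p) ∂μ ≤
        (∫⁻ ω, (M ω ^ q) ^ (r / q) ∂μ) ^ (1 / (r / q)) *
          (∫⁻ ω, (S ω ^ (q / p)) ^ (q' * p / (p' * q)) ∂μ) ^ (1 / (q' * p / (p' * q))) :=
      ENNReal.lintegral_mul_le_Lp_mul_Lq μ hκ (hMm.pow_const q).aemeasurable
      (hS.pow_const (q / p)).aemeasurable
    have e1 : q * (r / q) = r := by field_simp
    have e2 : q / p * (q' * p / (p' * q)) = q' / p' := by field_simp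
    simp_rw [← ENNReal.rpow_mul, e1, e2] at hhol
    refine hhol.trans ?_
    rw [← hI]
    have e3 : r * (1 / (r / q)) = q := by field_simp
    calc _ ≤ ((D r : ℝ≥0∞) ^ r * I) ^ (1 / (r / q)) * I ^ (1 / (q' * p / (p' * q))) := by
          gcongr
      _ = (D r : ℝ≥0∞) ^ q * (I ^ (1 / (r / q)) * I ^ (1 / (q' * p / (p' * q)))) := by
          rw [ENNReal.mul_rpow_of_nonneg _ _ (by positivity), ← ENNReal.rpow_mul, e3, mul_assoc]
      _ = (D r : ℝ≥0∞) ^ q * I := by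
          rw [← ENNReal.rpow_add_of_nonneg _ _ (by positivity) (by positivity), one_div, one_div,
            hκ.inv_add_inv_eq_one, ENNReal.rpow_one]
      _ ≤ _ := by
          gcongr
          exact le_max_right _ _
  -- For `q = p` the weight is constantly 1 and so is its conditional expectation. The exponent
  -- `q'/(q' - p')` is then a division by zero about which the Doob property says nothing; the 1 in
  -- the maximum takes over.
  · have hpq : p' = q' := hp.conjugate_eq.trans hq.conjugate_eq.symm
    subst hpq
    simp only [div_self hp0'.ne', div_self hp0.ne', sub_self, ENNReal.rpow_zero]
    rw [← lintegral_const_mul' _ _ (ENNReal.rpow_ne_top_of_nonneg hq0.le ENNReal.coe_ne_top)]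
    refine lintegral_mono fun ω => ?_
    gcongr
    refine iSup_le fun k => ?_
    rw [condLExp_const (hU k)]
    exact ENNReal.one_le_coe_iff.2 (le_max_left _ _)

end Weight

end CondMixed

/-! ### The pairing as a bounded bilinear map -/

namespace CondMixedLp

open Filter Topology

variable {Ω J : Type*} [Countable J] {m0 : MeasurableSpace Ω} {μ : Measure Ω}
  [IsProbabilityMeasure μ] {V U : J → MeasurableSpace Ω} {hU : ∀ k, U k ≤ m0} {p p' q q' : ℝ}

theorem tsum_lintegral_coord_mul_le (hp : p.HolderConjugate p') (hq : q.HolderConjugate q')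
    (X : CondMixedLp μ V U hU hp.lt.le hq.lt.le)
    (Y : CondMixedLp μ V U hU hp.symm.lt.le hq.symm.lt.le) :
    ∑' k, ∫⁻ ω, ‖X.coord k ω * Y.coord k ω‖ₑ ∂μ ≤ ‖X‖ₑ * ‖Y‖ₑ := by
  rw [enorm_eq, enorm_eq]
  exact CondMixed.tsum_lintegral_mul_le hU hp hq (fun k => (X.coord k).aemeasurable)
    (fun k => (Y.coord k).aemeasurable) X.condMixedENorm_coord_lt_top Y.condMixedENorm_coord_lt_top

theorem tsum_lintegral_coord_mul_ne_top (hp : p.HolderConjugate p') (hq : q.HolderConjugate q')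
    (X : CondMixedLp μ V U hU hp.lt.le hq.lt.le)
    (Y : CondMixedLp μ V U hU hp.symm.lt.le hq.symm.lt.le) :
    ∑' k, ∫⁻ ω, ‖X.coord k ω * Y.coord k ω‖ₑ ∂μ ≠ ∞ :=
  ((tsum_lintegral_coord_mul_le hp hq X Y).trans_lt
    (ENNReal.mul_lt_top enorm_lt_top enorm_lt_top)).ne

theorem integrable_coord_mul (hp : p.HolderConjugate p') (hq : q.HolderConjugate q')
    (X : CondMixedLp μ V U hU hp.lt.le hq.lt.le)
    (Y : CondMixedLp μ V U hU hp.symm.lt.le hq.symm.lt.le) (k : J) :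
    Integrable (fun ω => X.coord k ω * Y.coord k ω) μ :=
  ⟨(X.coord k).aestronglyMeasurable.mul (Y.coord k).aestronglyMeasurable,
    (ENNReal.ne_top_of_tsum_ne_top (tsum_lintegral_coord_mul_ne_top hp hq X Y) k).lt_top⟩

theorem hasSum_integral_abs_coord_mul (hp : p.HolderConjugate p') (hq : q.HolderConjugate q')
    (X : CondMixedLp μ V U hU hp.lt.le hq.lt.le)
    (Y : CondMixedLp μ V U hU hp.symm.lt.le hq.symm.lt.le) :
    HasSum (fun k => ∫ ω, |X.coord k ω * Y.coord k ω| ∂μ)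
      (∑' k, ∫⁻ ω, ‖X.coord k ω * Y.coord k ω‖ₑ ∂μ).toReal := by
  have h : ∀ k, ∫ ω, |X.coord k ω * Y.coord k ω| ∂μ =
      (∫⁻ ω, ‖X.coord k ω * Y.coord k ω‖ₑ ∂μ).toReal := fun k =>
    integral_norm_eq_lintegral_enorm (integrable_coord_mul hp hq X Y k).1
  have hne := tsum_lintegral_coord_mul_ne_top hp hq X Y
  simp_rw [h]
  rw [ENNReal.tsum_toReal_eq fun k => ENNReal.ne_top_of_tsum_ne_top hne k]
  exact ENNReal.hasSum_toReal hne

theorem summable_integral_coord_mul (hp : p.HolderConjugate p') (hq : q.HolderConjugate q')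
    (X : CondMixedLp μ V U hU hp.lt.le hq.lt.le)
    (Y : CondMixedLp μ V U hU hp.symm.lt.le hq.symm.lt.le) :
    Summable (fun k => ∫ ω, X.coord k ω * Y.coord k ω ∂μ) :=
  Summable.of_norm_bounded (hasSum_integral_abs_coord_mul hp hq X Y).summable
    fun _ => norm_integral_le_integral_norm _

/-- The pairing `⟨X, Y⟩ = ∑_k E X_k Y_k`, as a map from `F` to the dual of `E`. -/
noncomputable def pairing (hp : p.HolderConjugate p') (hq : q.HolderConjugate q') :
    CondMixedLp μ V U hU hp.symm.lt.le hq.symm.lt.le →L[ℝ]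
      StrongDual ℝ (CondMixedLp μ V U hU hp.lt.le hq.lt.le) :=
  LinearMap.mkContinuous₂
    (LinearMap.mk₂ ℝ (fun (Y : CondMixedLp μ V U hU hp.symm.lt.le hq.symm.lt.le)
      (X : CondMixedLp μ V U hU hp.lt.le hq.lt.le) => ∑' k, ∫ ω, X.coord k ω * Y.coord k ω ∂μ)
      (fun Y Y' X => by
        rw [← (summable_integral_coord_mul hp hq X Y).tsum_add
          (summable_integral_coord_mul hp hq X Y')]
        refine tsum_congr fun k => ?_
        rw [← integral_add (integrable_coord_mul hp hq X Y k) (integrable_coord_mul hp hq X Y' k)]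
        refine integral_congr_ae ?_
        filter_upwards [coord_add Y Y' k] with ω hω
        rw [hω, Pi.add_apply, mul_add])
      (fun c Y X => by
        rw [smul_eq_mul, ← tsum_mul_left]
        refine tsum_congr fun k => ?_
        rw [← integral_const_mul]
        refine integral_congr_ae ?_
        filter_upwards [coord_smul c Y k] with ω hω
        rw [hω, Pi.smul_apply, smul_eq_mul, mul_left_comm])
      (fun Y X X' => by
        rw [← (summable_integral_coord_mul hp hq X Y).tsum_add
          (summable_integral_coord_mul hp hq X' Y)]
        refine tsum_congr fun k => ?_
        rw [← integral_add (integrable_coord_mul hp hq X Y k) (integrable_coord_mul hp hq X' Y k)]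
        refine integral_congr_ae ?_
        filter_upwards [coord_add X X' k] with ω hω
        rw [hω, Pi.add_apply, add_mul])
      (fun c Y X => by
        rw [smul_eq_mul, ← tsum_mul_left]
        refine tsum_congr fun k => ?_
        rw [← integral_const_mul]
        refine integral_congr_ae ?_
        filter_upwards [coord_smul c X k] with ω hω
        rw [hω, Pi.smul_apply, smul_eq_mul, mul_assoc]))
    1 (fun Y X => by
      rw [LinearMap.mk₂_apply, one_mul]
      refine (tsum_of_norm_bounded (hasSum_integral_abs_coord_mul hp hq X Y)
        fun k => norm_integral_le_integral_norm _).trans ?_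
      have h := ENNReal.toReal_mono (ENNReal.mul_ne_top enorm_ne_top enorm_ne_top)
        (tsum_lintegral_coord_mul_le hp hq X Y)
      rwa [ENNReal.toReal_mul, toReal_enorm, toReal_enorm, mul_comm] at h)

theorem pairing_apply (hp : p.HolderConjugate p') (hq : q.HolderConjugate q')
    (Y : CondMixedLp μ V U hU hp.symm.lt.le hq.symm.lt.le)
    (X : CondMixedLp μ V U hU hp.lt.le hq.lt.le) :
    pairing hp hq Y X = ∑' k, ∫ ω, X.coord k ω * Y.coord k ω ∂μ := rfl

theorem norm_pairing_le (hp : p.HolderConjugate p') (hq : q.HolderConjugate q')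
    (Y : CondMixedLp μ V U hU hp.symm.lt.le hq.symm.lt.le) : ‖pairing hp hq Y‖ ≤ ‖Y‖ := by
  have h : ‖pairing (μ := μ) (V := V) (U := U) (hU := hU) hp hq‖ ≤ 1 :=
    LinearMap.mkContinuous₂_norm_le _ zero_le_one _
  simpa using (pairing hp hq).le_of_opNorm_le h Y

end CondMixedLp

/-! ### The norming element and the lower bound -/

namespace CondMixedLp

open Filter Topology

variable {Ω J : Type*} [Countable J] {m0 : MeasurableSpace Ω} {μ : Measure Ω}
  [IsProbabilityMeasure μ] {V U : J → MeasurableSpace Ω} {hU : ∀ k, U k ≤ m0} {p p' q q' : ℝ}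
  {D : ℝ → ℝ≥0}

/-- The element norming `Y`: with `S = ∑_k E(|Y_k|^p' | U_k)` it is given by
`X_k = sgn(Y_k) |Y_k|^(p'-1) E(S^(q'/p'-1) | U_k)`. -/
theorem exists_norming (hUV : ∀ k, U k ≤ V k) (hV : ∀ k, V k ≤ m0) (hD : HasDoobProperty μ U D)
    (hp : p.HolderConjugate p') (hq : q.HolderConjugate q') (hqp : q ≤ p)
    (Y : CondMixedLp μ V U hU hp.symm.lt.le hq.symm.lt.le) :
    ∃ (X : CondMixedLp μ V U hU hp.lt.le hq.lt.le) (t : ℝ), 0 ≤ t ∧ ‖Y‖ = t ^ (1 / q') ∧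
      pairing hp hq Y X = t ∧ ‖X‖ ≤ max 1 (D (q' / (q' - p'))) * t ^ (1 / q) := by
  have hp0 := hp.pos
  have hp0' := hp.symm.pos
  have hq0 := hq.pos
  have hq0' := hq.symm.pos
  choose y hy hyY using fun k => Y.aestronglyMeasurable_coord k
  have hy0 : ∀ k, AEMeasurable (y k) μ := fun k =>
    ((hy k).mono (hV k)).aestronglyMeasurable.aemeasurable
  set u : J → Ω → ℝ≥0∞ := fun k => condLExp (U k) μ (fun ω => ‖y k ω‖ₑ ^ p')
  set S : Ω → ℝ≥0∞ := fun ω => ∑' k, u k ω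
  have hSm : Measurable S := CondMixed.measurable_tsum_condLExp _
  set I := ∫⁻ ω, S ω ^ (q' / p') ∂μ with hI
  have hYn : condMixedENorm μ U p' q' (fun k => Y.coord k) = I ^ (1 / q') :=
    CondMixed.condMixedENorm_congr hyY
  have hfin : I ≠ ∞ := CondMixed.lintegral_rpow_ne_top_of_condMixedENorm hq.symm.lt.le
    ((CondMixed.condMixedENorm_congr hyY).symm.trans_lt Y.condMixedENorm_coord_lt_top)
  set h : Ω → ℝ≥0∞ := fun ω => S ω ^ (q' / p' - 1)
  have hhm : Measurable h := hSm.pow_const _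
  have hhfin : ∫⁻ ω, h ω ∂μ ≠ ∞ := CondMixed.lintegral_rpow_sub_one_ne_top hp hq hqp hfin
  set G : J → Ω → ℝ≥0∞ := fun k => condLExp (U k) μ h
  have hGm : ∀ k, Measurable[U k] (G k) := fun k => measurable_condLExp _ _ _
  have hGfin : ∀ k, ∀ᵐ ω ∂μ, G k ω ≠ ∞ := fun k => condLExp_ne_top hhfin
  set M : Ω → ℝ≥0∞ := fun ω => ⨆ k, G k ω
  have hW := CondMixed.lintegral_iSup_condLExp_weight_le hD hU hp hq hqp hSm hfin
  set C : ℝ≥0 := max 1 (D (q' / (q' - p')))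
  let x : J → Ω → ℝ := fun k ω => y k ω * |y k ω| ^ (p' - 2) * (G k ω).toReal
  have hxm : ∀ k, StronglyMeasurable[V k] (x k) := fun k => by
    have h1 : Measurable[V k] (y k) := (hy k).measurable
    have h2 : Measurable[V k] fun ω => (G k ω).toReal := ((hGm k).mono (hUV k) le_rfl).ennreal_toReal
    exact ((h1.mul ((measurable_norm.comp h1).pow_const (p' - 2))).mul h2).stronglyMeasurable
  have hxe : ∀ k, ∀ᵐ ω ∂μ, ‖x k ω‖ₑ = ‖y k ω‖ₑ ^ (p' - 1) * G k ω := fun k => by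
    filter_upwards [hGfin k] with ω hω
    rw [enorm_mul, CondMixed.enorm_mul_abs_rpow hp.symm.lt, ← ofReal_norm (G k ω).toReal,
      Real.norm_of_nonneg ENNReal.toReal_nonneg, ENNReal.ofReal_toReal hω]
  -- As `(p' - 1) p = p'`, the `p`-th power of `|x_k|` is `|y_k|^p'` times `G_k^p`, and the latter
  -- is `U k`-measurable and can be pulled out.
  have hxp : ∀ k, condLExp (U k) μ (fun ω => ‖x k ω‖ₑ ^ p) =ᵐ[μ] fun ω => G k ω ^ p * u k ω := by
    intro k
    refine (condLExp_congr_ae (Y := fun ω => G k ω ^ p * ‖y k ω‖ₑ ^ p') ?_).trans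
      (CondMixed.condLExp_mul_left (hU k) ((hy0 k).enorm.pow_const p') ((hGm k).pow_const p))
    filter_upwards [hxe k] with ω hω
    rw [hω, ENNReal.mul_rpow_of_nonneg _ _ hp0.le, ← ENNReal.rpow_mul, mul_comm,
      hp.symm.sub_one_mul_conj]
  have hsum : ∀ᵐ ω ∂μ, (∑' k, condLExp (U k) μ (fun ω => ‖x k ω‖ₑ ^ p) ω) ^ (q / p) ≤
      M ω ^ q * S ω ^ (q / p) := by
    filter_upwards [ae_all_iff.2 hxp] with ω hω
    calc _ = (∑' k, G k ω ^ p * u k ω) ^ (q / p) := by simp_rw [hω]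
      _ ≤ (∑' k, M ω ^ p * u k ω) ^ (q / p) := by
          refine ENNReal.rpow_le_rpow (ENNReal.tsum_le_tsum fun k => ?_) (by positivity)
          gcongr
          exact le_iSup (fun k => G k ω) k
      _ = M ω ^ q * S ω ^ (q / p) := by
          rw [ENNReal.tsum_mul_left, ENNReal.mul_rpow_of_nonneg _ _ (by positivity),
            ← ENNReal.rpow_mul, mul_div_cancel₀ _ hp0.ne']
  have hxnorm : condMixedENorm μ U p q x ≤ C * I ^ (1 / q) := by
    calc condMixedENorm μ U p q x ≤ ((C : ℝ≥0∞) ^ q * I) ^ (1 / q) :=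
          ENNReal.rpow_le_rpow ((lintegral_mono_ae hsum).trans hW) (by positivity)
      _ = _ := by
          rw [ENNReal.mul_rpow_of_nonneg _ _ (by positivity), one_div, ENNReal.rpow_rpow_inv hq0.ne']
  have hCI : C * I ^ (1 / q) ≠ ∞ := ENNReal.mul_ne_top ENNReal.coe_ne_top
    (ENNReal.rpow_ne_top_of_nonneg (by positivity) hfin)
  obtain ⟨X, hX⟩ := exists_coord_eq (hU := hU) (hp := hp.lt.le) (hq := hq.lt.le) hV
    (fun k => (hxm k).aestronglyMeasurable) (hxnorm.trans_lt hCI.lt_top)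
  -- `|X_k Y_k| = |y_k|^p' E(h | U_k)`; self-adjointness moves the conditional expectation from `h`
  -- to `|y_k|^p'`, so that the sum over `k` produces `h * S`.
  have hterm : ∀ k, ∫⁻ ω, ‖X.coord k ω * Y.coord k ω‖ₑ ∂μ = ∫⁻ ω, h ω * u k ω ∂μ := fun k => by
    rw [← CondMixed.lintegral_condLExp_mul_comm (hU k) hhm.aemeasurable
      ((hy0 k).enorm.pow_const p')]
    refine lintegral_congr_ae ?_
    filter_upwards [hX k, hyY k, hxe k] with ω h1 h2 h3
    rw [h1, h2, enorm_mul, h3, mul_right_comm, mul_comm]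
    congr 1
    nth_rewrite 2 [← ENNReal.rpow_one ‖y k ω‖ₑ]
    rw [← ENNReal.rpow_add_of_nonneg _ _ hp.symm.sub_one_pos.le zero_le_one, sub_add_cancel]
  have htsum : ∑' k, ∫⁻ ω, ‖X.coord k ω * Y.coord k ω‖ₑ ∂μ = I := by
    simp_rw [hterm]
    refine (lintegral_tsum fun k =>
      (hhm.mul (measurable_condLExp' _ _ _)).aemeasurable).symm.trans (lintegral_congr fun ω => ?_)
    simp only [Pi.mul_apply]
    rw [ENNReal.tsum_mul_left]
    have h1 : 0 ≤ q' / p' - 1 := by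
      rw [sub_nonneg, one_le_div hp0']
      rcases hqp.lt_or_eq with h | rfl
      · exact (CondMixed.conj_lt_conj hp hq h).le
      · exact (hp.conjugate_eq.trans hq.conjugate_eq.symm).le
    change S ω ^ (q' / p' - 1) * S ω = _
    nth_rewrite 2 [← ENNReal.rpow_one (S ω)]
    rw [← ENNReal.rpow_add_of_nonneg _ _ h1 zero_le_one, sub_add_cancel]
  refine ⟨X, I.toReal, ENNReal.toReal_nonneg, ?_, ?_, ?_⟩
  · rw [norm_def, hYn, ENNReal.toReal_rpow]
  -- Each product `X_k Y_k` is nonnegative, so the pairing is the sum of the absolute integrals.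
  · rw [pairing_apply, ← htsum]
    refine (tsum_congr fun k => ?_).trans
      (hasSum_integral_abs_coord_mul hp hq X Y).tsum_eq
    refine integral_congr_ae ?_
    filter_upwards [hX k, hyY k] with ω h1 h2
    rw [h1, h2, eq_comm, abs_of_nonneg]
    have : x k ω * y k ω = y k ω ^ 2 * (|y k ω| ^ (p' - 2) * (G k ω).toReal) := by ring
    rw [this]
    positivity
  · rw [norm_def, CondMixed.condMixedENorm_congr hX, ENNReal.toReal_rpow]
    have := ENNReal.toReal_mono hCI hxnorm
    rwa [ENNReal.toReal_mul, ENNReal.coe_toReal] at this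

/-- Evaluating the functional at the norming element gives `t ≤ ‖pairing hp hq Y‖ ‖X‖` with `‖X‖` at
most a constant times `t^(1/q)`; cancelling `t^(1/q)` leaves `t^(1/q') = ‖Y‖`. -/
theorem norm_le_norm_pairing (hUV : ∀ k, U k ≤ V k) (hV : ∀ k, V k ≤ m0)
    (hD : HasDoobProperty μ U D) (hp : p.HolderConjugate p') (hq : q.HolderConjugate q')
    (hqp : q ≤ p) (Y : CondMixedLp μ V U hU hp.symm.lt.le hq.symm.lt.le) :
    ‖Y‖ ≤ max 1 (D (q' / (q' - p'))) * ‖pairing hp hq Y‖ := by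
  obtain ⟨X, t, ht, hY, hYX, hX⟩ := exists_norming hUV hV hD hp hq hqp Y
  have hq0 := hq.pos
  have hq0' := hq.symm.pos
  rcases ht.eq_or_lt with rfl | ht
  · rw [hY, Real.zero_rpow (by positivity)]
    positivity
  have h1 : t ≤ ‖pairing hp hq Y‖ * ‖X‖ := by
    rw [← hYX]
    exact (le_abs_self _).trans ((pairing hp hq Y).le_opNorm X)
  have h2 : t ^ (1 / q') * t ^ (1 / q) = t := by
    rw [← Real.rpow_add ht, one_div, one_div, hq.symm.inv_add_inv_eq_one, Real.rpow_one]
  have h3 : 0 < t ^ (1 / q) := Real.rpow_pos_of_pos ht _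
  rw [hY]
  refine le_of_mul_le_mul_right ?_ h3
  rw [h2]
  calc t ≤ ‖pairing hp hq Y‖ * ‖X‖ := h1
    _ ≤ ‖pairing hp hq Y‖ * (max 1 (D (q' / (q' - p'))) * t ^ (1 / q)) := by gcongr
    _ = _ := by ring

end CondMixedLp

/-! ### Radon–Nikodym densities and monotone convergence -/

namespace CondMixed

open Filter Topology

/-- The Radon–Nikodym theorem for a countably additive set function on measurable sets. -/
theorem exists_integrable_density {Ω : Type*} {m0 : MeasurableSpace Ω} {μ : Measure Ω}
    [IsFiniteMeasure μ] {ν : Set Ω → ℝ}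
    (hν : ∀ f : ℕ → Set Ω, (∀ i, MeasurableSet (f i)) → Pairwise (Function.onFun Disjoint f) →
      HasSum (fun i => ν (f i)) (ν (⋃ i, f i)))
    (hnull : ∀ A, MeasurableSet A → μ A = 0 → ν A = 0) :
    ∃ y : Ω → ℝ, Measurable y ∧ Integrable y μ ∧
      ∀ A, MeasurableSet A → ν A = ∫ ω in A, y ω ∂μ := by
  classical
  let s : SignedMeasure Ω :=
    { measureOf' := fun A => if MeasurableSet A then ν A else 0
      empty' := by simpa using hnull ∅ .empty measure_empty
      not_measurable' := fun A hA => if_neg hA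
      m_iUnion' := fun f hf hd => by
        simpa [hf, MeasurableSet.iUnion hf] using hν f hf hd }
  have hs : ∀ A, MeasurableSet A → s A = ν A := fun A hA => if_pos hA
  have hac : VectorMeasure.AbsolutelyContinuous s μ.toENNRealVectorMeasure := by
    refine VectorMeasure.AbsolutelyContinuous.mk fun A hA h => ?_
    rw [Measure.toENNRealVectorMeasure_apply_measurable hA] at h
    rw [hs A hA, hnull A hA h]
  refine ⟨s.rnDeriv μ, s.measurable_rnDeriv μ, s.integrable_rnDeriv μ, fun A hA => ?_⟩
  rw [← hs A hA, ← withDensityᵥ_apply (s.integrable_rnDeriv μ) hA,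
    SignedMeasure.withDensityᵥ_rnDeriv_eq s μ hac]

/-- Applying Radon–Nikodym to the restriction of `μ` to `m` makes the density `m`-measurable, as
adaptedness to `V` requires. -/
theorem exists_integrable_density_trim {Ω : Type*} {m m0 : MeasurableSpace Ω} {μ : Measure Ω}
    [IsFiniteMeasure μ] (hm : m ≤ m0) {ν : Set Ω → ℝ}
    (hν : ∀ f : ℕ → Set Ω, (∀ i, MeasurableSet[m] (f i)) → Pairwise (Function.onFun Disjoint f) →
      HasSum (fun i => ν (f i)) (ν (⋃ i, f i)))
    (hnull : ∀ A, MeasurableSet[m] A → μ A = 0 → ν A = 0) :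
    ∃ y : Ω → ℝ, StronglyMeasurable[m] y ∧ Integrable y μ ∧
      ∀ A, MeasurableSet[m] A → ν A = ∫ ω in A, y ω ∂μ := by
  obtain ⟨y, hy, hyi, hyA⟩ := @exists_integrable_density Ω m (μ.trim hm) _ ν hν
    fun A hA h => hnull A hA (by rwa [trim_measurableSet_eq hm hA] at h)
  refine ⟨y, hy.stronglyMeasurable, integrable_of_integrable_trim hm hyi, fun A hA => ?_⟩
  rw [hyA A hA, setIntegral_trim hm hy.stronglyMeasurable hA]

theorem tsum_iSup_of_monotone {J : Type*} [Countable J] {f : ℕ → J → ℝ≥0∞}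
    (hf : ∀ k, Monotone fun n => f n k) : ∑' k, ⨆ n, f n k = ⨆ n, ∑' k, f n k := by
  let _ : MeasurableSpace J := ⊤
  have h := lintegral_iSup (μ := Measure.count) (f := f) (fun _ => measurable_from_top)
    fun i j hij k => hf k hij
  simpa only [lintegral_count] using h

/-- The monotone convergence theorem for the conditional mixed norm. -/
theorem condMixedENorm_le_of_monotone {Ω J : Type*} [Countable J] {m0 : MeasurableSpace Ω}
    {μ : Measure Ω} [IsProbabilityMeasure μ] {U : J → MeasurableSpace Ω} {p q : ℝ}
    (hU : ∀ k, U k ≤ m0) (hp : 1 ≤ p) (hq : 1 ≤ q) {X : ℕ → J → Ω → ℝ} {Z : J → Ω → ℝ}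
    (hX : ∀ n k, AEMeasurable (X n k) μ) (hmono : ∀ k ω, Monotone fun n => ‖X n k ω‖ₑ)
    (hsup : ∀ k ω, ⨆ n, ‖X n k ω‖ₑ = ‖Z k ω‖ₑ) {B : ℝ≥0∞}
    (hB : ∀ n, condMixedENorm μ U p q (X n) ≤ B) : condMixedENorm μ U p q Z ≤ B := by
  have hp0 : 0 < p := by linarith
  have hq0 : 0 < q := by linarith
  have hpow : ∀ {s : ℝ}, 0 < s → ∀ a : ℕ → ℝ≥0∞, (⨆ n, a n) ^ s = ⨆ n, a n ^ s :=
    fun {s} hs a => (ENNReal.orderIsoRpow s hs).map_iSup a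
  have hE : ∀ k, condLExp (U k) μ (fun ω => ‖Z k ω‖ₑ ^ p) =ᵐ[μ]
      fun ω => ⨆ n, condLExp (U k) μ (fun ω => ‖X n k ω‖ₑ ^ p) ω := fun k => by
    have h : (fun ω => ‖Z k ω‖ₑ ^ p) = fun ω => ⨆ n, ‖X n k ω‖ₑ ^ p := by
      ext ω
      rw [← hsup k ω, hpow hp0]
    rw [h]
    exact condLExp_iSup (hU k) (fun n => (hX n k).enorm.pow_const p)
      (ae_of_all _ fun ω i j hij => ENNReal.rpow_le_rpow (hmono k ω hij) hp0.le)
  have hEmono : ∀ᵐ ω ∂μ, ∀ k n, condLExp (U k) μ (fun ω => ‖X n k ω‖ₑ ^ p) ω ≤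
      condLExp (U k) μ (fun ω => ‖X (n + 1) k ω‖ₑ ^ p) ω := by
    simp_rw [ae_all_iff]
    exact fun k n => condLExp_mono
      (ae_of_all _ fun ω => ENNReal.rpow_le_rpow (hmono k ω n.le_succ) hp0.le)
  have hSmono : ∀ᵐ ω ∂μ, Monotone fun n =>
      (∑' k, condLExp (U k) μ (fun ω => ‖X n k ω‖ₑ ^ p) ω) ^ (q / p) := by
    filter_upwards [hEmono] with ω hω
    exact monotone_nat_of_le_succ fun n =>
      ENNReal.rpow_le_rpow (ENNReal.tsum_le_tsum fun k => hω k n) (by positivity)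
  have hS : ∀ᵐ ω ∂μ, (∑' k, condLExp (U k) μ (fun ω => ‖Z k ω‖ₑ ^ p) ω) ^ (q / p) =
      ⨆ n, (∑' k, condLExp (U k) μ (fun ω => ‖X n k ω‖ₑ ^ p) ω) ^ (q / p) := by
    filter_upwards [ae_all_iff.2 hE, hEmono] with ω h1 h2
    simp_rw [h1]
    rw [tsum_iSup_of_monotone fun k => monotone_nat_of_le_succ (h2 k), hpow (by positivity)]
  unfold condMixedENorm at hB ⊢
  simp_rw [one_div, ENNReal.rpow_inv_le_iff hq0] at hB ⊢
  rw [lintegral_congr_ae hS, lintegral_iSup'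
    (fun n => ((measurable_tsum_condLExp _).pow_const _).aemeasurable) hSmono]
  exact iSup_le hB

end CondMixed

/-! ### Densities of a functional -/

namespace CondMixedLp

open Filter Topology

variable {Ω J : Type*} [Countable J] {m0 : MeasurableSpace Ω} {μ : Measure Ω}
  {V U : J → MeasurableSpace Ω} {hU : ∀ k, U k ≤ m0}

theorem coord_sum {p q : ℝ} {hp : 1 ≤ p} {hq : 1 ≤ q} {ι : Type*} (s : Finset ι)
    (Z : ι → CondMixedLp μ V U hU hp hq) (k : J) :
    (∑ i ∈ s, Z i).coord k =ᵐ[μ] fun ω => ∑ i ∈ s, (Z i).coord k ω := by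
  classical
  induction s using Finset.induction_on with
  | empty =>
    simp only [Finset.sum_empty]
    exact coord_zero k
  | insert a s ha ih =>
    rw [Finset.sum_insert ha]
    filter_upwards [coord_add (Z a) (∑ i ∈ s, Z i) k, ih] with ω h1 h2
    rw [h1, Pi.add_apply, h2, Finset.sum_insert ha]

variable [IsProbabilityMeasure μ] {p q : ℝ} {hp : 1 ≤ p} {hq : 1 ≤ q}

/-- Each point lies in at most one of the disjoint sets, so the error at `k` is dominated by the
indicator of the union, and dominated convergence for the mixed norm applies. It yields countable
additivity of a functional on indicators. -/
theorem tendsto_sum_isIndicator {k : J} {f : ℕ → Set Ω}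
    (hf : Pairwise (Function.onFun Disjoint f)) {Z : ℕ → CondMixedLp μ V U hU hp hq}
    (hZ : ∀ i, (Z i).IsIndicator k (f i)) {W : CondMixedLp μ V U hU hp hq}
    (hW : W.IsIndicator k (⋃ i, f i)) {s : ℕ → Finset ℕ} (hs : Tendsto s atTop atTop) :
    Tendsto (fun n => ∑ i ∈ s n, Z i) atTop (𝓝 W) := by
  have hpt : ∀ ω i, ω ∈ f i → ∀ t : Finset ℕ,
      ∑ j ∈ t, (f j).indicator (fun _ => (1 : ℝ)) ω = if i ∈ t then 1 else 0 := by
    intro ω i hi t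
    have h : ∀ j ∈ t, (f j).indicator (fun _ => (1 : ℝ)) ω = if i = j then 1 else 0 := by
      intro j _
      split_ifs with hij
      · subst hij
        simp [hi]
      · exact Set.indicator_of_notMem (Set.disjoint_left.1 (hf hij) hi) _
    rw [Finset.sum_congr rfl h, Finset.sum_ite_eq]
  have hpt' : ∀ ω, ω ∉ ⋃ i, f i → ∀ t : Finset ℕ,
      ∑ j ∈ t, (f j).indicator (fun _ => (1 : ℝ)) ω = 0 := by
    intro ω hω t
    refine Finset.sum_eq_zero fun j _ => Set.indicator_of_notMem (fun h => hω ?_) _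
    exact Set.mem_iUnion_of_mem j h
  have hcoord : ∀ n j, (∑ i ∈ s n, Z i - W).coord j =ᵐ[μ]
      fun ω => ∑ i ∈ s n, (Z i).coord j ω - W.coord j ω := fun n j => by
    filter_upwards [coord_sub (∑ i ∈ s n, Z i) W j, coord_sum (s n) Z j] with ω h1 h2
    rw [h1, Pi.sub_apply, h2]
  have hk : ∀ᵐ ω ∂μ, ∀ n, (∑ i ∈ s n, Z i - W).coord k ω =
      ∑ i ∈ s n, (f i).indicator (fun _ => (1 : ℝ)) ω -
        (⋃ i, f i).indicator (fun _ => (1 : ℝ)) ω := by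
    filter_upwards [ae_all_iff.2 fun n => hcoord n k, ae_all_iff.2 fun i => (hZ i).1, hW.1]
      with ω h1 h2 h3 n
    rw [h1, h3]
    simp_rw [h2]
  have hj : ∀ j, j ≠ k → ∀ᵐ ω ∂μ, ∀ n, (∑ i ∈ s n, Z i - W).coord j ω = 0 := fun j hj => by
    filter_upwards [ae_all_iff.2 fun n => hcoord n j, ae_all_iff.2 fun i => (hZ i).2 j hj,
      hW.2 j hj] with ω h1 h2 h3 n
    rw [h1, h3]
    simp [h2]
  have hlim : Tendsto (fun n => ‖∑ i ∈ s n, Z i - W‖ₑ) atTop (𝓝 0) := by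
    simp_rw [enorm_eq]
    refine CondMixed.tendsto_condMixedENorm_zero hU hp hq (Z := fun j => W.coord j)
      (fun n j => ((∑ i ∈ s n, Z i - W).coord j).aemeasurable) (fun j => (W.coord j).aemeasurable)
      W.condMixedENorm_coord_lt_top (fun n j => ?_) fun j => ?_
    · rcases eq_or_ne j k with rfl | hjk
      · filter_upwards [hk, hW.1] with ω h1 h2
        rw [h1, h2]
        by_cases hω : ω ∈ ⋃ i, f i
        · obtain ⟨i, hi⟩ := Set.mem_iUnion.1 hω
          rw [hpt ω i hi, Set.indicator_of_mem hω]
          split_ifs <;> simp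
        · rw [hpt' ω hω, Set.indicator_of_notMem hω]
          simp
      · filter_upwards [hj j hjk] with ω h1
        simp [h1]
    · rcases eq_or_ne j k with rfl | hjk
      · filter_upwards [hk] with ω h1
        simp_rw [h1]
        by_cases hω : ω ∈ ⋃ i, f i
        · obtain ⟨i, hi⟩ := Set.mem_iUnion.1 hω
          refine tendsto_const_nhds.congr' ?_
          filter_upwards [hs.eventually (eventually_ge_atTop {i})] with n hn
          rw [hpt ω i hi, Set.indicator_of_mem hω, if_pos (hn (Finset.mem_singleton_self i)),
            sub_self]
        · simp_rw [hpt' ω hω, Set.indicator_of_notMem hω]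
          simp
      · filter_upwards [hj j hjk] with ω h1
        simp [h1]
  rw [tendsto_iff_edist_tendsto_0]
  simpa [edist_eq_enorm_sub] using hlim

/-- A functional on the conditional mixed-norm space is given on indicator families by
integration against a density. -/
theorem exists_density (hV : ∀ k, V k ≤ m0) (φ : StrongDual ℝ (CondMixedLp μ V U hU hp hq))
    (k : J) : ∃ y : Ω → ℝ, StronglyMeasurable[V k] y ∧ Integrable y μ ∧
      ∀ A, MeasurableSet[V k] A → ∀ Z, IsIndicator Z k A → φ Z = ∫ ω in A, y ω ∂μ := by
  classical
  -- Non-measurable sets receive an irrelevant value so that the set function is defined on all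
  -- sets.
  have hex : ∀ A : Set Ω, ∃ Z : CondMixedLp μ V U hU hp hq,
      MeasurableSet[V k] A → Z.IsIndicator k A := fun A => by
    by_cases hA : MeasurableSet[V k] A
    · obtain ⟨Z, hZ⟩ := exists_isIndicator (hU := hU) (hp := hp) (hq := hq) (μ := μ) hV k hA
      exact ⟨Z, fun _ => hZ⟩
    · exact ⟨0, fun h => absurd h hA⟩
  choose ind hind using hex
  have huniq : ∀ A, MeasurableSet[V k] A → ∀ Z, IsIndicator Z k A → Z = ind A :=
    fun A hA Z hZ => ext_coord fun j => by
      rcases eq_or_ne j k with rfl | hj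
      · exact hZ.1.trans (hind A hA).1.symm
      · exact (hZ.2 j hj).trans ((hind A hA).2 j hj).symm
  have hadd : ∀ f : ℕ → Set Ω, (∀ i, MeasurableSet[V k] (f i)) →
      Pairwise (Function.onFun Disjoint f) →
      HasSum (fun i => φ (ind (f i))) (φ (ind (⋃ i, f i))) := fun f hf hd => by
    -- Unconditional summation is a limit along finite subsets of `ℕ`; it suffices to test it on
    -- sequences of them, which is what dominated convergence can handle.
    refine tendsto_of_seq_tendsto fun s hs => ?_
    have h := tendsto_sum_isIndicator hd (fun i => hind _ (hf i))
      (hind _ (MeasurableSet.iUnion hf)) hs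
    have h' := (φ.continuous.tendsto _).comp h
    simpa [Function.comp_def] using h'
  have hnull : ∀ A, MeasurableSet[V k] A → μ A = 0 → φ (ind A) = 0 := fun A hA hA0 => by
    have h0 : 0 = ind A := huniq A hA 0
      ⟨(coord_zero k).trans (indicator_meas_zero hA0).symm, fun j _ => coord_zero j⟩
    rw [← h0, map_zero]
  obtain ⟨y, hy, hyi, hyA⟩ := CondMixed.exists_integrable_density_trim (hV k) hadd hnull
  refine ⟨y, hy, hyi, fun A hA Z hZ => ?_⟩
  rw [huniq A hA Z hZ]
  exact hyA A hA

end CondMixedLp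

/-! ### Surjectivity and duality in both variables -/

namespace CondMixedLp

open Filter Topology

variable {Ω J : Type*} [Countable J] {m0 : MeasurableSpace Ω} {μ : Measure Ω}
  [IsProbabilityMeasure μ] {V U : J → MeasurableSpace Ω} {hU : ∀ k, U k ≤ m0} {p p' q q' : ℝ}

/-- Cutting off each coordinate decreases absolute values and preserves adaptedness. Composing a
functional with this contraction truncates its densities without increasing its norm. -/
theorem exists_restrict {hp : 1 ≤ p} {hq : 1 ≤ q} (hV : ∀ k, V k ≤ m0) {A : J → Set Ω}
    (hA : ∀ k, MeasurableSet[V k] (A k)) :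
    ∃ R : CondMixedLp μ V U hU hp hq →L[ℝ] CondMixedLp μ V U hU hp hq,
      ‖R‖ ≤ 1 ∧ ∀ Z k, (R Z).coord k =ᵐ[μ] (A k).indicator (Z.coord k) := by
  have hle : ∀ (Z : CondMixedLp μ V U hU hp hq) k ω,
      ‖(A k).indicator (Z.coord k) ω‖ₑ ≤ ‖Z.coord k ω‖ₑ := fun Z k ω => by
    rw [enorm_indicator_eq_indicator_enorm]
    exact Set.indicator_le_self _ _ _
  have hmono : ∀ Z : CondMixedLp μ V U hU hp hq,
      condMixedENorm μ U p q (fun k => (A k).indicator (Z.coord k)) ≤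
        condMixedENorm μ U p q (fun k => Z.coord k) := fun Z =>
    CondMixed.condMixedENorm_mono hp hq fun k => ae_of_all _ (hle Z k)
  have hex : ∀ Z : CondMixedLp μ V U hU hp hq, ∃ Z' : CondMixedLp μ V U hU hp hq,
      ∀ k, Z'.coord k =ᵐ[μ] (A k).indicator (Z.coord k) := fun Z => by
    refine exists_coord_eq hV (fun k => ?_) ((hmono Z).trans_lt Z.condMixedENorm_coord_lt_top)
    obtain ⟨g, hg, hgZ⟩ := Z.aestronglyMeasurable_coord k
    exact ⟨(A k).indicator g, hg.indicator (hA k), by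
      filter_upwards [hgZ] with ω hω
      by_cases h : ω ∈ A k <;> simp [h, hω]⟩
  choose R hR using hex
  let L : CondMixedLp μ V U hU hp hq →ₗ[ℝ] CondMixedLp μ V U hU hp hq :=
    { toFun := R
      map_add' := fun Z W => ext_coord fun k => by
        filter_upwards [hR (Z + W) k, hR Z k, hR W k, coord_add Z W k, coord_add (R Z) (R W) k]
          with ω h1 h2 h3 h4 h5
        rw [h1, h5, Pi.add_apply, h2, h3]
        by_cases h : ω ∈ A k <;> simp [h, h4]
      map_smul' := fun c Z => ext_coord fun k => by
        filter_upwards [hR (c • Z) k, hR Z k, coord_smul c Z k, coord_smul c (R Z) k]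
          with ω h1 h2 h3 h4
        rw [h1, RingHom.id_apply, h4, Pi.smul_apply, h2]
        by_cases h : ω ∈ A k <;> simp [h, h3] }
  refine ⟨L.mkContinuous 1 fun Z => ?_, L.mkContinuous_norm_le zero_le_one _, hR⟩
  rw [one_mul]
  change ‖R Z‖ ≤ ‖Z‖
  rw [norm_def, norm_def, CondMixed.condMixedENorm_congr (hR Z)]
  exact ENNReal.toReal_mono Z.condMixedENorm_coord_lt_top.ne (hmono Z)

theorem pairing_isIndicator (hp : p.HolderConjugate p') (hq : q.HolderConjugate q')
    (Y : CondMixedLp μ V U hU hp.symm.lt.le hq.symm.lt.le)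
    {Z : CondMixedLp μ V U hU hp.lt.le hq.lt.le} {k : J} {A : Set Ω} (hA : MeasurableSet A)
    (hZ : Z.IsIndicator k A) : pairing hp hq Y Z = ∫ ω in A, Y.coord k ω ∂μ := by
  rw [pairing_apply, tsum_eq_single k, ← integral_indicator hA]
  · refine integral_congr_ae ?_
    filter_upwards [hZ.1] with ω hω
    rw [hω]
    by_cases h : ω ∈ A <;> simp [h]
  · intro j hj
    refine integral_eq_zero_of_ae ?_
    filter_upwards [hZ.2 j hj] with ω hω
    simp [hω]

theorem strongDual_eq_of_isIndicator {hp : 1 ≤ p} {hq : 1 ≤ q} (hV : ∀ k, V k ≤ m0)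
    {φ ψ : StrongDual ℝ (CondMixedLp μ V U hU hp hq)}
    (h : ∀ k A, MeasurableSet[V k] A → ∀ Z, IsIndicator Z k A → φ Z = ψ Z) : φ = ψ :=
  sub_eq_zero.1 <| strongDual_ext hV fun k A hA Z hZ => by
    rw [_root_.sub_apply, h k A hA Z hZ, sub_self]

/-- If `F` embeds into the dual of `E`, then it is all of the dual. -/
theorem pairing_surjective (hV : ∀ k, V k ≤ m0) (hp : p.HolderConjugate p')
    (hq : q.HolderConjugate q') {C : ℝ} (hC0 : 0 ≤ C)
    (hC : ∀ Y : CondMixedLp μ V U hU hp.symm.lt.le hq.symm.lt.le, ‖Y‖ ≤ C * ‖pairing hp hq Y‖) :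
    Function.Surjective (pairing (μ := μ) (V := V) (U := U) (hU := hU) hp hq) := by
  intro φ
  choose y hy hyi hyφ using exists_density hV φ
  obtain ⟨e, he⟩ := exists_injective_nat J
  -- The truncation keeps finitely many coordinates and bounded values, so the truncated family is
  -- in `F` although nothing is yet known about `y` beyond integrability.
  let A : ℕ → J → Set Ω := fun n k => {ω | e k ≤ n ∧ ‖y k ω‖ ≤ n}
  have hA : ∀ n k, MeasurableSet[V k] (A n k) := fun n k => by
    have h : MeasurableSet[V k] {ω | ‖y k ω‖ ≤ n} :=
      (measurable_norm.comp (hy k).measurable) measurableSet_Iic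
    by_cases hk : e k ≤ n
    · simpa [A, hk] using h
    · simp [A, hk]
  have hAmono : ∀ k, Monotone fun n => A n k := fun k i j hij ω hω =>
    ⟨hω.1.trans hij, hω.2.trans (by exact_mod_cast hij)⟩
  have hyn : ∀ n k, StronglyMeasurable[V k] ((A n k).indicator (y k)) := fun n k =>
    (hy k).indicator (hA n k)
  have hfin : ∀ n, condMixedENorm μ U p' q' (fun k => (A n k).indicator (y k)) < ∞ := fun n => by
    refine CondMixed.condMixedENorm_lt_top_of_bounded hU hp.symm.lt.le hq.symm.lt.le
      ((Set.finite_Iic n).preimage he.injOn).toFinset (fun k hk => ?_) (c := n) fun k ω => ?_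
    · have hk' : ¬ e k ≤ n := by simpa using hk
      simp [A, hk', Pi.zero_def]
    · by_cases h : ω ∈ A n k
      · rw [Set.indicator_of_mem h, ← ofReal_norm]
        refine (ENNReal.ofReal_le_ofReal h.2).trans ?_
        simp
      · simp [h]
  choose Y hY using fun n => exists_coord_eq (hU := hU) (hp := hp.symm.lt.le)
    (hq := hq.symm.lt.le) hV (fun k => (hyn n k).aestronglyMeasurable) (hfin n)
  have hbound : ∀ n, ‖Y n‖ ≤ C * ‖φ‖ := fun n => by
    obtain ⟨R, hR1, hR⟩ := exists_restrict (μ := μ) (U := U) (hU := hU) (hp := hp.lt.le)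
      (hq := hq.lt.le) hV (hA n)
    -- On the indicator of `B` at `k` both sides are the integral of `y k` over `B ∩ A n k`, and
    -- functionals are determined by indicator families.
    have hRφ : pairing hp hq (Y n) = φ.comp R := by
      refine strongDual_eq_of_isIndicator hV fun k B hB Z hZ => ?_
      rw [pairing_isIndicator hp hq (Y n) (hV k _ hB) hZ, ContinuousLinearMap.comp_apply,
        hyφ k (B ∩ A n k) (hB.inter (hA n k)), ← setIntegral_indicator (hV k _ (hA n k))]
      · exact integral_congr_ae (ae_restrict_of_ae (hY n k))
      · refine ⟨?_, fun j hj => ?_⟩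
        · filter_upwards [hR Z k, hZ.1] with ω h1 h2
          rw [h1, Set.inter_comm, ← Set.indicator_indicator]
          by_cases h : ω ∈ A n k <;> simp [h, h2]
        · filter_upwards [hR Z j, hZ.2 j hj] with ω h1 h2
          rw [h1]
          by_cases h : ω ∈ A n j <;> simp [h, h2]
    refine (hC (Y n)).trans (mul_le_mul_of_nonneg_left ?_ hC0)
    rw [hRφ]
    refine (φ.opNorm_comp_le R).trans ?_
    exact mul_le_of_le_one_right (norm_nonneg _) hR1
  have hnorm : condMixedENorm μ U p' q' y ≤ ENNReal.ofReal (C * ‖φ‖) := by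
    refine CondMixed.condMixedENorm_le_of_monotone hU hp.symm.lt.le hq.symm.lt.le
      (X := fun n k => (A n k).indicator (y k))
      (fun n k => ((hyn n k).mono (hV k)).aestronglyMeasurable.aemeasurable)
      (fun k ω i j hij => ?_) (fun k ω => ?_) fun n => ?_
    · simp only [enorm_indicator_eq_indicator_enorm]
      exact Set.indicator_le_indicator_of_subset (hAmono k hij) (fun _ => zero_le) ω
    · refine le_antisymm (iSup_le fun n => ?_) ?_
      · rw [enorm_indicator_eq_indicator_enorm]
        exact Set.indicator_le_self _ _ _
      · obtain ⟨n, hn⟩ := exists_nat_ge ‖y k ω‖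
        refine le_iSup_of_le (max (e k) n) ?_
        rw [Set.indicator_of_mem]
        exact ⟨le_max_left _ _, hn.trans (by exact_mod_cast le_max_right _ _)⟩
    · rw [← CondMixed.condMixedENorm_congr (hY n), ← enorm_eq, ← ofReal_norm]
      exact ENNReal.ofReal_le_ofReal (hbound n)
  obtain ⟨Y₀, hY₀⟩ := exists_coord_eq (hU := hU) (hp := hp.symm.lt.le) (hq := hq.symm.lt.le)
    (μ := μ) hV (fun k => (hy k).aestronglyMeasurable) (hnorm.trans_lt ENNReal.ofReal_lt_top)
  refine ⟨Y₀, strongDual_eq_of_isIndicator hV fun k B hB Z hZ => ?_⟩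
  rw [pairing_isIndicator hp hq Y₀ (hV k _ hB) hZ, hyφ k B hB Z hZ]
  exact integral_congr_ae (ae_restrict_of_ae (hY₀ k))

theorem pairing_symm_apply (hp : p.HolderConjugate p') (hq : q.HolderConjugate q')
    (X : CondMixedLp μ V U hU hp.lt.le hq.lt.le)
    (Y : CondMixedLp μ V U hU hp.symm.lt.le hq.symm.lt.le) :
    pairing hp.symm hq.symm X Y = pairing hp hq Y X := by
  simp_rw [pairing_apply, mul_comm]

/-- By the Hahn–Banach theorem, if `F` is the dual of `E`, then `E` embeds into the dual of `F`. -/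
theorem norm_le_norm_pairing_symm (hp : p.HolderConjugate p') (hq : q.HolderConjugate q') {C : ℝ}
    (hC : ∀ Y : CondMixedLp μ V U hU hp.symm.lt.le hq.symm.lt.le, ‖Y‖ ≤ C * ‖pairing hp hq Y‖)
    (hC0 : 0 ≤ C)
    (hsurj : Function.Surjective (pairing (μ := μ) (V := V) (U := U) (hU := hU) hp hq))
    (X : CondMixedLp μ V U hU hp.lt.le hq.lt.le) :
    ‖X‖ ≤ C * ‖pairing hp.symm hq.symm X‖ := by
  obtain ⟨g, hg1, hgX⟩ := exists_dual_vector'' ℝ X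
  obtain ⟨Y, rfl⟩ := hsurj g
  have hY : ‖Y‖ ≤ C := (hC Y).trans (mul_le_of_le_one_right hC0 hg1)
  calc ‖X‖ = pairing hp.symm hq.symm X Y := by
        rw [pairing_symm_apply hp hq, hgX]
        rfl
    _ ≤ ‖pairing hp.symm hq.symm X Y‖ := le_abs_self _
    _ ≤ ‖pairing hp.symm hq.symm X‖ * ‖Y‖ := (pairing hp.symm hq.symm X).le_opNorm Y
    _ ≤ ‖pairing hp.symm hq.symm X‖ * C := by gcongr
    _ = _ := mul_comm _ _

/-- The pairing is bounded below in both variables. -/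
theorem norm_le_norm_pairing_and_symm {D : ℝ → ℝ≥0} (hUV : ∀ k, U k ≤ V k) (hV : ∀ k, V k ≤ m0)
    (hD : HasDoobProperty μ U D) (hp : p.HolderConjugate p') (hq : q.HolderConjugate q')
    (hqp : q ≤ p) {C : ℝ} (hC1 : 1 ≤ C) (hCD : D (q' / (q' - p')) ≤ C) :
    (∀ Y : CondMixedLp μ V U hU hp.symm.lt.le hq.symm.lt.le, ‖Y‖ ≤ C * ‖pairing hp hq Y‖) ∧
    ∀ X : CondMixedLp μ V U hU hp.lt.le hq.lt.le, ‖X‖ ≤ C * ‖pairing hp.symm hq.symm X‖ := by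
  have hC0 : 0 ≤ C := by linarith
  have h : ∀ Y : CondMixedLp μ V U hU hp.symm.lt.le hq.symm.lt.le, ‖Y‖ ≤ C * ‖pairing hp hq Y‖ :=
    fun Y => (norm_le_norm_pairing hUV hV hD hp hq hqp Y).trans <| by
      gcongr
      simp [hC1, hCD]
  exact ⟨h, norm_le_norm_pairing_symm hp hq h hC0 (pairing_surjective hV hp hq hC0 h)⟩

theorem exists_equiv (hV : ∀ k, V k ≤ m0) (hp : p.HolderConjugate p') (hq : q.HolderConjugate q')
    {C : ℝ} (hC1 : 1 ≤ C)
    (hC : ∀ Y : CondMixedLp μ V U hU hp.symm.lt.le hq.symm.lt.le, ‖Y‖ ≤ C * ‖pairing hp hq Y‖) :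
    ∃ Φ : CondMixedLp μ V U hU hp.symm.lt.le hq.symm.lt.le ≃L[ℝ]
        StrongDual ℝ (CondMixedLp μ V U hU hp.lt.le hq.lt.le),
      (∀ Y, Φ Y = pairing hp hq Y) ∧ ∀ Y, C⁻¹ * ‖Y‖ ≤ ‖Φ Y‖ ∧ ‖Φ Y‖ ≤ C * ‖Y‖ := by
  have hC0 : 0 < C := by linarith
  have hinj : Function.Injective (pairing (μ := μ) (V := V) (U := U) (hU := hU) hp hq) := by
    rw [injective_iff_map_eq_zero]
    intro Y hY
    have := hC Y
    rw [hY, norm_zero, mul_zero] at this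
    exact norm_le_zero_iff.1 this
  let Φ := LinearEquiv.ofBijective
    (pairing (μ := μ) (V := V) (U := U) (hU := hU) hp hq).toLinearMap
    ⟨hinj, pairing_surjective hV hp hq hC0.le hC⟩
  refine ⟨Φ.toContinuousLinearEquivOfBounds 1 C (fun Y => ?_) fun φ => ?_, fun Y => rfl,
    fun Y => ⟨?_, ?_⟩⟩
  · rw [one_mul]
    exact norm_pairing_le hp hq Y
  · have h := hC (Φ.symm φ)
    rwa [show pairing hp hq (Φ.symm φ) = φ from Φ.apply_symm_apply φ] at h
  · rw [inv_mul_le_iff₀ hC0]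
    exact hC Y
  · exact (norm_pairing_le hp hq Y).trans (le_mul_of_one_le_left (norm_nonneg _) hC1)

end CondMixedLp

theorem mainTheorem3 {p p' q q' : ℝ} (hp : p.HolderConjugate p') (hq : q.HolderConjugate q')
    (D : ℝ → ℝ≥0) :
    ∃ C : ℝ, 0 < C ∧
      ∀ {Ω J : Type*} [Countable J] {m0 : MeasurableSpace Ω} (μ : Measure Ω)
        [IsProbabilityMeasure μ] (U V : J → MeasurableSpace Ω)
        (hUV : ∀ k, U k ≤ V k) (hV : ∀ k, V k ≤ m0),
        HasDoobProperty μ U D →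
        let E := CondMixedLp μ V U (fun k => (hUV k).trans (hV k)) hp.lt.le hq.lt.le
        let F := CondMixedLp μ V U (fun k => (hUV k).trans (hV k)) hp.symm.lt.le hq.symm.lt.le
        (∀ (X : E) (Y : F), (∀ k, Integrable (fun ω => X.coord k ω * Y.coord k ω) μ) ∧
          Summable (fun k => ∫ ω, |X.coord k ω * Y.coord k ω| ∂μ)) ∧
        (∃ Φ : F ≃L[ℝ] StrongDual ℝ E,
          (∀ (Y : F) (X : E), Φ Y X = ∑' k, ∫ ω, X.coord k ω * Y.coord k ω ∂μ) ∧
          ∀ Y : F, C⁻¹ * ‖Y‖ ≤ ‖Φ Y‖ ∧ ‖Φ Y‖ ≤ C * ‖Y‖) ∧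
        (∃ Ψ : E ≃L[ℝ] StrongDual ℝ F,
          (∀ (X : E) (Y : F), Ψ X Y = ∑' k, ∫ ω, X.coord k ω * Y.coord k ω ∂μ) ∧
          ∀ X : E, C⁻¹ * ‖X‖ ≤ ‖Ψ X‖ ∧ ‖Ψ X‖ ≤ C * ‖X‖) := by
  -- One Doob constant serves `q ≤ p`, the other the conjugate case. The one whose exponent is
  -- outside `(1, ∞)` carries no information and only enlarges `C`; the 1 covers `p = q` and the
  -- Hölder bound.
  set C : ℝ := max 1 (max (D (q' / (q' - p'))) (D (q / (q - p))))
  have hC1 : 1 ≤ C := le_max_left _ _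
  refine ⟨C, by linarith, ?_⟩
  intro Ω J _ m0 μ _ U V hUV hV hD E F
  have hbounds : (∀ Y : F, ‖Y‖ ≤ C * ‖CondMixedLp.pairing hp hq Y‖) ∧
      ∀ X : E, ‖X‖ ≤ C * ‖CondMixedLp.pairing hp.symm hq.symm X‖ := by
    rcases le_total q p with h | h
    · exact CondMixedLp.norm_le_norm_pairing_and_symm hUV hV hD hp hq h hC1
        ((le_max_left _ _).trans (le_max_right _ _))
    -- Conjugation reverses the order, so the previous case applies to `(p', q')`, with `E` and `F`
    -- exchanged; its two conclusions come in the opposite order.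
    · have h' : q' ≤ p' := by
        rcases h.lt_or_eq with h | rfl
        · exact (CondMixed.conj_lt_conj hq hp h).le
        · exact (hq.conjugate_eq.trans hp.conjugate_eq.symm).le
      exact (CondMixedLp.norm_le_norm_pairing_and_symm hUV hV hD hp.symm hq.symm h' hC1
        ((le_max_right _ _).trans (le_max_right _ _))).symm
  obtain ⟨Φ, hΦ, hΦ'⟩ := CondMixedLp.exists_equiv hV hp hq hC1 hbounds.1
  obtain ⟨Ψ, hΨ, hΨ'⟩ := CondMixedLp.exists_equiv hV hp.symm hq.symm hC1 hbounds.2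
  refine ⟨fun X Y => ⟨CondMixedLp.integrable_coord_mul hp hq X Y,
    (CondMixedLp.hasSum_integral_abs_coord_mul hp hq X Y).summable⟩,
    ⟨Φ, fun Y X => ?_, hΦ'⟩, ⟨Ψ, fun X Y => ?_, hΨ'⟩⟩
  · rw [hΦ, CondMixedLp.pairing_apply]
  · rw [hΨ, CondMixedLp.pairing_symm_apply hp hq, CondMixedLp.pairing_apply]
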